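/- **Conventions.** All groups are finite and $R$ is a commutative ring. For subgroups $D\le G\times H$, $E\le H\times K$ put $D*E=\{(g,k)\mid \exists h\in H:\ (g,h)\in D,\ (h,k)\in E\}$; for $L\le H$ and $K\le G$ put $D*L=\{g\mid \exists h\in L:\ (g,h)\in D\}$ and $K*D=\{h\mid\exists g\in K:\ (g,h)\in D\}$; let $p_1(D)\le G$, $p_2(D)\le H$ be the projections of $D$, let $k_2(D)=\{h\in H\mid (1,h)\in D\}$, and $\Delta(K)=\{(k,k)\mid k\in K\}$. A $(G,H)$-biset is a finite set with commuting left $G$- and right $H$-actions; $(G\times H)_u=\{(g,h)\mid gu=uh\}$ is the stabilizer of $u$; $B(G,H)$ is the Grothendieck group of $(G,H)$-bisets with respect to disjoint union; and $U\times_HV$ is the set of orbits of $H$ on $U\times V$ under $h(u,v)=(uh^{-1},hv)$. Let $\mathcal G$ be a class of finite groups, let $\Sigma_{\mathcal G}(G)$ be the set of subgroups of $G$ that belong to $\mathcal G$, and for $G,H\in\mathcal G$ let $\mathcal S(G,H)$ be a set of subgroups of $G\times H$. Assume, for all $G,H,K\in\mathcal G$: 1. (i) $\Delta(G)\in\mathcal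 S(G,G)$. 2. (ii) $\mathcal S(G,H)$ is closed under $G\times H$-conjugation. 3. (iii) $D*E\in\mathcal S(G,K)$ for all $D\in\mathcal S(G,H)$ and $E\in\mathcal S(H,K)$. 4. (vii) For all $D\in\mathcal S(G,H)$ one has $p_1(D),p_2(D)\in\mathcal G$; for every $L\in\Sigma_{\mathcal G}(p_2(D))$ one has $D*L\in\mathcal G$ and $D*\Delta(L)=D\cap(G\times L)\in\mathcal S(D*L,L)$; and for every $K'\in\Sigma_{\mathcal G}(p_1(D))$ one has $K'*D\in\mathcal G$ and $\Delta(K')*D=D\cap(K'\times H)\in\mathcal S(K',K'*D)$. 5. (viii) $A\cap B\in\mathcal G$ for all $A,B\in\Sigma_{\mathcal G}(G)$. 6. $k_2(D)=1$ for every $D\in\mathcal S(G,H)$. Let $\mathcal S^+(G,H)$ be the set of all $D\le G\times H$ such that $p_1(D),p_2(D)\in\mathcal G$ and $D\in\mathcal S(p_1(D),p_2(D))$; then $(\mathcal G,\mathcal S^+)$ also satisfies (i)–(iii). Let $\mathcal D$ (resp. $\mathcal D^+$) be the category with object class $\mathcal G$, in which $\mathrm{Hom}(H,G)$ is the subgroup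 of $B(G,H)$ generated by the classes $[(G\times H)/D]$ with $D\in\mathcal S(G,H)$ (resp. $D\in\mathcal S^+(G,H)$), composition is induced by $(U,V)\mapsto U\times_HV$, and the identity of $G$ is $[G]$. Let $\mathcal F_{\mathcal D,R}$ and $\mathcal F_{\mathcal D^+,R}$ be the categories of additive functors from $\mathcal D$, resp. $\mathcal D^+$, to $R$-modules. For $F\in\mathcal F_{\mathcal D,R}$ and $G\in\mathcal G$ let $$F^+(G)=\Bigl(\prod_{K\in\Sigma_{\mathcal G}(G)}F(K)\Bigr)^G$$ be the $R$-module of all tuples $(a_K)$ with ${}^g(a_K)=a_{{}^gK}$ for all $g\in G$ and all $K$, where ${}^g(-)=F(\mathrm{iso}_{c_g})$ and $c_g\colon K\to{}^gK$, $k\mapsto gkg^{-1}$. For a $(G,H)$-biset $U$ all of whose stabilizers are in $\mathcal S^+(G,H)$, for $u\in U$ and for $K\in\Sigma_{\mathcal G}(G)$, put $K^u=K*(G\times H)_u$ and $(K\times H)_u=(G\times H)_u\cap(K\times H)$, and define $$F^+(U)\colon F^+(H)\to F^+(G),\qquad (a_L)_L\mapsto\Biggl(\ \sum_{\substack{u\in[U/H]\\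 K\le p_1((G\times H)_u)}}F\Bigl(\Bigl[\frac{K\times K^u}{(K\times H)_u}\Bigr]\Bigr)(a_{K^u})\Biggr)_{K},$$ where $[U/H]$ is any set of representatives of the $H$-orbits of $U$. **Theorem.** These formulas are well defined, and they make every $F^+$ a biset functor on $\mathcal D^+$ over $R$, i.e. there is an additive functor $F^+\colon\mathcal D^+\to{}_R\mathsf{Mod}$ with the above values $F^+(G)$ on objects and with $F^+([U])=F^+(U)$ for every $U$ as above. Together with $\eta\mapsto\eta^+$, $\eta^+_G\bigl((a_K)_K\bigr)=(\eta_K(a_K))_K$, on natural transformations, this defines an $R$-linear functor $-^+\colon\mathcal F_{\mathcal D,R}\to\mathcal F_{\mathcal D^+,R}$. -/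

import Mathlib

open CategoryTheory

universe u v w

noncomputable section

/-! ### Finite groups on subsets of a fixed type, and their subgroups

Groups are literal: a finite group is a subset of `Ω` together with a multiplication on it, so that
a subgroup of a subgroup of `G` is a subgroup of `G`, and isomorphic groups need not be equal. -/

/-- A finite group whose underlying set is a subset of `Ω`. -/
structure FinGrp (Ω : Type u) where
  carrier : Set Ω
  [finite : Finite carrier]
  [group : Group carrier]

namespace FinGrp

variable {Ω : Type u}

instance : CoeSort (FinGrp Ω) (Type u) := ⟨fun G => G.carrier⟩

instance (G : FinGrp Ω) : Group G := G.group

instance (G : FinGrp Ω) : Finite G := G.finite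

/-- The elements of a subgroup `K` of `G` are the elements of the subset underlying `sub G K`. -/
def subEquiv (G : FinGrp Ω) (K : Subgroup G) :
    (((↑) : G.carrier → Ω) '' (K : Set G) : Set Ω) ≃ K :=
  (Equiv.Set.image ((↑) : G.carrier → Ω) (K : Set G) Subtype.val_injective).symm

/-- A subgroup `K` of `G`, as a finite group in its own right: the underlying subset of `Ω` is the
set of elements of `K`, and the multiplication is the one of `G`. -/
def sub (G : FinGrp Ω) (K : Subgroup G) : FinGrp Ω :=
  letI : Group (((↑) : G.carrier → Ω) '' (K : Set G) : Set Ω) := (subEquiv G K).group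
  haveI : Finite (((↑) : G.carrier → Ω) '' (K : Set G) : Set Ω) :=
    Finite.of_equiv K (subEquiv G K).symm
  { carrier := ((↑) : G.carrier → Ω) '' (K : Set G) }

/-- The isomorphism of `sub G K` with the subgroup `K`; it is the identity on elements. -/
def subIso (G : FinGrp Ω) (K : Subgroup G) : G.sub K ≃* K :=
  letI : Group (((↑) : G.carrier → Ω) '' (K : Set G) : Set Ω) := (subEquiv G K).group
  (subEquiv G K).mulEquiv

/-- The inclusion of a subgroup. -/
def incl (G : FinGrp Ω) (K : Subgroup G) : G.sub K →* G :=
  K.subtype.comp (G.subIso K).toMonoidHom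

theorem incl_mem (G : FinGrp Ω) (K : Subgroup G) (x : G.sub K) : G.incl K x ∈ K :=
  (G.subIso K x).2

theorem incl_injective (G : FinGrp Ω) (K : Subgroup G) : Function.Injective (G.incl K) :=
  Subtype.val_injective.comp (G.subIso K).injective

theorem exists_incl (G : FinGrp Ω) (K : Subgroup G) {g : G} (hg : g ∈ K) :
    ∃ x, G.incl K x = g :=
  ⟨(G.subIso K).symm ⟨g, hg⟩, by simp [incl]⟩

theorem incl_coe (G : FinGrp Ω) (K : Subgroup G) (x : G.sub K) : (G.incl K x : Ω) = x := by
  have h : (subEquiv G K).symm (subEquiv G K x) = x := Equiv.symm_apply_apply _ x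
  exact congrArg Subtype.val h

theorem ext' {G H : FinGrp Ω} (hc : G.carrier = H.carrier)
    (hm : ∀ (x y : G) (x' y' : H), (x : Ω) = x' → (y : Ω) = y' → ((x * y : G) : Ω) = (x' * y' : H)) :
    G = H := by
  obtain ⟨C, gC⟩ := G
  rename_i fC
  obtain ⟨C', gC'⟩ := H
  rename_i fC'
  dsimp only at hc
  subst hc
  congr 1
  apply Group.ext
  funext x y
  exact Subtype.ext (hm x y x y rfl rfl)

theorem mem_sub (G : FinGrp Ω) (K : Subgroup G) {x : Ω} :
    x ∈ (G.sub K).carrier ↔ ∃ g : G, g ∈ K ∧ (g : Ω) = x := Iff.rfl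

theorem sub_sub (G : FinGrp Ω) (K L : Subgroup G) (h : L ≤ K) :
    (G.sub K).sub (L.comap (G.incl K)) = G.sub L := by
  apply ext'
  · ext x
    rw [mem_sub, mem_sub]
    constructor
    · rintro ⟨y, hy, rfl⟩
      exact ⟨G.incl K y, hy, G.incl_coe K y⟩
    · rintro ⟨y, hy, rfl⟩
      obtain ⟨z, rfl⟩ := G.exists_incl K (h hy)
      exact ⟨z, hy, (G.incl_coe K z).symm⟩
  · intro x y x' y' hx hy
    rw [← incl_coe, ← incl_coe, ← incl_coe, map_mul, map_mul, map_mul]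
    have h1 : G.incl K ((G.sub K).incl _ x) = G.incl L x' :=
      Subtype.ext (by rw [incl_coe, incl_coe, incl_coe, hx])
    have h2 : G.incl K ((G.sub K).incl _ y) = G.incl L y' :=
      Subtype.ext (by rw [incl_coe, incl_coe, incl_coe, hy])
    rw [h1, h2]

theorem sub_top (G : FinGrp Ω) : G.sub ⊤ = G := by
  apply ext'
  · ext x
    rw [mem_sub]
    exact ⟨fun ⟨g, _, hg⟩ => hg ▸ g.2, fun h => ⟨⟨x, h⟩, trivial, rfl⟩⟩
  · intro x y x' y' hx hy
    rw [← incl_coe, map_mul, show G.incl ⊤ x = x' from Subtype.ext (by rw [incl_coe, hx]),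
      show G.incl ⊤ y = y' from Subtype.ext (by rw [incl_coe, hy])]

/-- A subgroup `D ≤ G × H`, intersected with `K × L` and viewed as a subgroup of `K × L`. -/
def restrict {G H : FinGrp Ω} (D : Subgroup (G × H)) (K : Subgroup G) (L : Subgroup H) :
    Subgroup (G.sub K × H.sub L) :=
  D.comap ((G.incl K).prodMap (H.incl L))

theorem mem_restrict {G H : FinGrp Ω} {D : Subgroup (G × H)} {K : Subgroup G} {L : Subgroup H}
    {x : G.sub K × H.sub L} : x ∈ restrict D K L ↔ (G.incl K x.1, H.incl L x.2) ∈ D := Iff.rfl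

end FinGrp

/-! ### Subgroups of direct products -/

section Products

variable {G H K : Type u} [Group G] [Group H] [Group K]

/-- The first projection of a subgroup of `G × H`. -/
def prodFst (D : Subgroup (G × H)) : Subgroup G := D.map (MonoidHom.fst G H)

/-- The second projection of a subgroup of `G × H`. -/
def prodSnd (D : Subgroup (G × H)) : Subgroup H := D.map (MonoidHom.snd G H)

/-- `k₂(D) = {h ∈ H | (1, h) ∈ D}`. -/
def kerSnd (D : Subgroup (G × H)) : Subgroup H := D.comap (MonoidHom.inr G H)

/-- `Δ(G) ≤ G × G`. -/
def diag (G : Type u) [Group G] : Subgroup (G × G) :=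
  ((MonoidHom.id G).prod (MonoidHom.id G)).range

/-- `D * E = {(g, k) | ∃ h, (g, h) ∈ D ∧ (h, k) ∈ E}`. -/
def star (D : Subgroup (G × H)) (E : Subgroup (H × K)) : Subgroup (G × K) where
  carrier := {x | ∃ h, (x.1, h) ∈ D ∧ (h, x.2) ∈ E}
  mul_mem' := by
    rintro x y ⟨h, h1, h2⟩ ⟨h', h1', h2'⟩
    exact ⟨h * h', D.mul_mem h1 h1', E.mul_mem h2 h2'⟩
  one_mem' := ⟨1, D.one_mem, E.one_mem⟩
  inv_mem' := by
    rintro x ⟨h, h1, h2⟩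
    exact ⟨h⁻¹, D.inv_mem h1, E.inv_mem h2⟩

/-- `D * L = {g | ∃ h ∈ L, (g, h) ∈ D}`, for `L ≤ H`. -/
def starRight (D : Subgroup (G × H)) (L : Subgroup H) : Subgroup G where
  carrier := {g | ∃ h ∈ L, (g, h) ∈ D}
  mul_mem' := by
    rintro x y ⟨h, h1, h2⟩ ⟨h', h1', h2'⟩
    exact ⟨h * h', L.mul_mem h1 h1', D.mul_mem h2 h2'⟩
  one_mem' := ⟨1, L.one_mem, D.one_mem⟩
  inv_mem' := by
    rintro x ⟨h, h1, h2⟩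
    exact ⟨h⁻¹, L.inv_mem h1, D.inv_mem h2⟩

/-- `K * D = {h | ∃ g ∈ K, (g, h) ∈ D}`, for `K ≤ G`. -/
def starLeft (K : Subgroup G) (D : Subgroup (G × H)) : Subgroup H where
  carrier := {h | ∃ g ∈ K, (g, h) ∈ D}
  mul_mem' := by
    rintro x y ⟨h, h1, h2⟩ ⟨h', h1', h2'⟩
    exact ⟨h * h', K.mul_mem h1 h1', D.mul_mem h2 h2'⟩
  one_mem' := ⟨1, K.one_mem, D.one_mem⟩
  inv_mem' := by
    rintro x ⟨h, h1, h2⟩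
    exact ⟨h⁻¹, K.inv_mem h1, D.inv_mem h2⟩

/-- The conjugate `ᵍK = g K g⁻¹`. -/
def conjSub (g : G) (K : Subgroup G) : Subgroup G := K.map (MulAut.conj g).toMonoidHom

theorem mem_prodFst {D : Subgroup (G × H)} {g : G} : g ∈ prodFst D ↔ ∃ h, (g, h) ∈ D := by
  simp [prodFst]

theorem mem_prodSnd {D : Subgroup (G × H)} {h : H} : h ∈ prodSnd D ↔ ∃ g, (g, h) ∈ D := by
  simp [prodSnd]

theorem mem_diag {x y : G} : (x, y) ∈ diag G ↔ x = y := by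
  simp [diag, MonoidHom.mem_range]

theorem mem_star {D : Subgroup (G × H)} {E : Subgroup (H × K)} {x : G × K} :
    x ∈ star D E ↔ ∃ h, (x.1, h) ∈ D ∧ (h, x.2) ∈ E := Iff.rfl

theorem mem_starRight {D : Subgroup (G × H)} {L : Subgroup H} {g : G} :
    g ∈ starRight D L ↔ ∃ h ∈ L, (g, h) ∈ D := Iff.rfl

theorem mem_starLeft {D : Subgroup (G × H)} {L : Subgroup G} {h : H} :
    h ∈ starLeft L D ↔ ∃ g ∈ L, (g, h) ∈ D := Iff.rfl

theorem mem_conjSub {g x : G} {K : Subgroup G} : x ∈ conjSub g K ↔ g⁻¹ * x * g ∈ K := by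
  constructor
  · rintro ⟨y, hy, rfl⟩
    simpa [mul_assoc] using hy
  · intro h
    exact ⟨_, h, by simp [mul_assoc]⟩

end Products

/-! ### The data `(𝒢, 𝒮)` -/

/-- A class `𝒢` of finite groups and a family `𝒮(G, H)`, `G, H ∈ 𝒢`, of sets of subgroups of
`G × H`, satisfying Axioms (i), (ii) and (iii). Only the values `𝒮(G, H)` for `G, H ∈ 𝒢` matter. -/
structure GSPair (Ω : Type u) where
  𝒢 : Set (FinGrp Ω)
  𝒮 : ∀ G H : FinGrp Ω, Set (Subgroup (G × H))
  diag_mem : ∀ G ∈ 𝒢, diag G ∈ 𝒮 G G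
  conj_mem : ∀ G ∈ 𝒢, ∀ H ∈ 𝒢, ∀ D ∈ 𝒮 G H, ∀ x : G × H, conjSub x D ∈ 𝒮 G H
  star_mem : ∀ G ∈ 𝒢, ∀ H ∈ 𝒢, ∀ K ∈ 𝒢, ∀ D ∈ 𝒮 G H, ∀ E ∈ 𝒮 H K, star D E ∈ 𝒮 G K

namespace GSPair

variable {Ω : Type u} (P : GSPair Ω)

/-- `Σ_𝒢(G)`: the subgroups of `G` that belong to `𝒢`. -/
def Sig (G : FinGrp Ω) : Set (Subgroup G) := {K | G.sub K ∈ P.𝒢}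

/-- Axiom (vii), stated for both projections: the projections of `D ∈ 𝒮(G, H)` belong to `𝒢`;
if `L ∈ Σ_𝒢(p₂(D))` then `D * L ∈ 𝒢` and `D * Δ(L) = D ∩ (G × L)` is in `𝒮(D * L, L)`; and if
`K ∈ Σ_𝒢(p₁(D))` then `K * D ∈ 𝒢` and `Δ(K) * D = D ∩ (K × H)` is in `𝒮(K, K * D)`. -/
structure AxiomSeven : Prop where
  snd_mem : ∀ G ∈ P.𝒢, ∀ H ∈ P.𝒢, ∀ D ∈ P.𝒮 G H, prodSnd D ∈ P.Sig H
  right : ∀ G ∈ P.𝒢, ∀ H ∈ P.𝒢, ∀ D ∈ P.𝒮 G H, ∀ L ∈ P.Sig H, L ≤ prodSnd D →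
    starRight D L ∈ P.Sig G ∧
      FinGrp.restrict D (starRight D L) L ∈ P.𝒮 (G.sub (starRight D L)) (H.sub L)
  fst_mem : ∀ G ∈ P.𝒢, ∀ H ∈ P.𝒢, ∀ D ∈ P.𝒮 G H, prodFst D ∈ P.Sig G
  left : ∀ G ∈ P.𝒢, ∀ H ∈ P.𝒢, ∀ D ∈ P.𝒮 G H, ∀ K ∈ P.Sig G, K ≤ prodFst D →
    starLeft K D ∈ P.Sig H ∧
      FinGrp.restrict D K (starLeft K D) ∈ P.𝒮 (G.sub K) (H.sub (starLeft K D))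

/-- The intersection of two subgroups in `Σ_𝒢(G)` is in `Σ_𝒢(G)`, for `G ∈ 𝒢`. -/
def InterClosed : Prop :=
  ∀ G ∈ P.𝒢, ∀ A ∈ P.Sig G, ∀ B ∈ P.Sig G, A ⊓ B ∈ P.Sig G

/-- `k₂(D) = 1` for all `D ∈ 𝒮(G, H)` and all `G, H ∈ 𝒢`. -/
def KerSndTrivial : Prop :=
  ∀ G ∈ P.𝒢, ∀ H ∈ P.𝒢, ∀ D ∈ P.𝒮 G H, kerSnd D = ⊥

/-- `𝒮⁺(G, H)`: the `D ≤ G × H` with `p₁(D), p₂(D) ∈ 𝒢` and `D ∈ 𝒮(p₁(D), p₂(D))`. -/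
def SPlus (G H : FinGrp Ω) : Set (Subgroup (G × H)) :=
  {D | prodFst D ∈ P.Sig G ∧ prodSnd D ∈ P.Sig H ∧
    FinGrp.restrict D (prodFst D) (prodSnd D) ∈ P.𝒮 (G.sub (prodFst D)) (H.sub (prodSnd D))}

variable {P}

/-- Membership in `𝒮` only depends on the underlying subset of `Ω × Ω`. -/
theorem mem_S_congr {G G' H H' : FinGrp Ω} (hG : G = G') (hH : H = H') {D : Subgroup (G × H)}
    {D' : Subgroup (G' × H')}
    (h : ∀ (g : G) (h : H) (g' : G') (h' : H'), (g : Ω) = g' → (h : Ω) = h' →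
      ((g, h) ∈ D ↔ (g', h') ∈ D')) (hD : D ∈ P.𝒮 G H) : D' ∈ P.𝒮 G' H' := by
  subst hG hH
  have : D = D' := by
    ext ⟨x, y⟩
    exact h x y x y rfl rfl
  exact this ▸ hD

theorem mem_Sig_comap {G : FinGrp Ω} {K L : Subgroup G} (h : L ≤ K) :
    L.comap (G.incl K) ∈ P.Sig (G.sub K) ↔ L ∈ P.Sig G := by
  simp only [Sig, Set.mem_ofPred_eq, FinGrp.sub_sub G K L h]

/-- The right half of Axiom (vii) for elements of `𝒮⁺`. -/
theorem SPlus.right (h7 : P.AxiomSeven) {G H : FinGrp Ω} {D : Subgroup (G × H)}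
    (hD : D ∈ P.SPlus G H) {L : Subgroup H} (hL : L ∈ P.Sig H) (hle : L ≤ prodSnd D) :
    starRight D L ∈ P.Sig G ∧
      FinGrp.restrict D (starRight D L) L ∈ P.𝒮 (G.sub (starRight D L)) (H.sub L) := by
  obtain ⟨h1, h2, h3⟩ := hD
  have key := h7.right _ h1 _ h2 _ h3 (L.comap (H.incl _)) ((mem_Sig_comap hle).2 hL) (by
    intro y hy
    obtain ⟨g, hg⟩ := mem_prodSnd.1 (hle hy)
    obtain ⟨x, rfl⟩ := G.exists_incl (prodFst D) (mem_prodFst.2 ⟨_, hg⟩)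
    exact mem_prodSnd.2 ⟨x, hg⟩)
  have hle' : starRight D L ≤ prodFst D := fun g ⟨h, _, hh⟩ => mem_prodFst.2 ⟨h, hh⟩
  have heq : starRight (FinGrp.restrict D (prodFst D) (prodSnd D)) (L.comap (H.incl _)) =
      (starRight D L).comap (G.incl _) := by
    ext x
    constructor
    · rintro ⟨y, hy, hxy⟩
      exact ⟨_, hy, hxy⟩
    · rintro ⟨h, hh, hx⟩
      obtain ⟨y, rfl⟩ := H.exists_incl (prodSnd D) (hle hh)
      exact ⟨y, hh, hx⟩
  rw [heq, mem_Sig_comap hle'] at key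
  refine ⟨key.1, mem_S_congr (FinGrp.sub_sub _ _ _ hle') (FinGrp.sub_sub _ _ _ hle) ?_ key.2⟩
  intro g h g' h' hg hh
  simp only [FinGrp.mem_restrict]
  rw [show G.incl _ ((G.sub _).incl _ g) = G.incl _ g' from
      Subtype.ext (by simp only [FinGrp.incl_coe, hg]),
    show H.incl _ ((H.sub _).incl _ h) = H.incl _ h' from
      Subtype.ext (by simp only [FinGrp.incl_coe, hh])]

/-- The left half of Axiom (vii) for elements of `𝒮⁺`. -/
theorem SPlus.left (h7 : P.AxiomSeven) {G H : FinGrp Ω} {D : Subgroup (G × H)}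
    (hD : D ∈ P.SPlus G H) {K : Subgroup G} (hK : K ∈ P.Sig G) (hle : K ≤ prodFst D) :
    starLeft K D ∈ P.Sig H ∧
      FinGrp.restrict D K (starLeft K D) ∈ P.𝒮 (G.sub K) (H.sub (starLeft K D)) := by
  obtain ⟨h1, h2, h3⟩ := hD
  have key := h7.left _ h1 _ h2 _ h3 (K.comap (G.incl _)) ((mem_Sig_comap hle).2 hK) (by
    intro y hy
    obtain ⟨h, hh⟩ := mem_prodFst.1 (hle hy)
    obtain ⟨x, rfl⟩ := H.exists_incl (prodSnd D) (mem_prodSnd.2 ⟨_, hh⟩)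
    exact mem_prodFst.2 ⟨x, hh⟩)
  have hle' : starLeft K D ≤ prodSnd D := fun h ⟨g, _, hg⟩ => mem_prodSnd.2 ⟨g, hg⟩
  have heq : starLeft (K.comap (G.incl _)) (FinGrp.restrict D (prodFst D) (prodSnd D)) =
      (starLeft K D).comap (H.incl _) := by
    ext x
    constructor
    · rintro ⟨y, hy, hxy⟩
      exact ⟨_, hy, hxy⟩
    · rintro ⟨h, hh, hx⟩
      obtain ⟨y, rfl⟩ := G.exists_incl (prodFst D) (hle hh)
      exact ⟨y, hh, hx⟩
  rw [heq, mem_Sig_comap hle'] at key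
  refine ⟨key.1, mem_S_congr (FinGrp.sub_sub _ _ _ hle) (FinGrp.sub_sub _ _ _ hle') ?_ key.2⟩
  intro g h g' h' hg hh
  simp only [FinGrp.mem_restrict]
  rw [show G.incl _ ((G.sub _).incl _ g) = G.incl _ g' from
      Subtype.ext (by simp only [FinGrp.incl_coe, hg]),
    show H.incl _ ((H.sub _).incl _ h) = H.incl _ h' from
      Subtype.ext (by simp only [FinGrp.incl_coe, hh])]

/-- The graph of a conjugation isomorphism `K → ᵍK`, `k ↦ g k g⁻¹`, belongs to `𝒮(ᵍK, K)`. -/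
theorem conj_graph_mem (h7 : P.AxiomSeven) {G : FinGrp Ω} (hG : G ∈ P.𝒢) (g : G)
    {K : Subgroup G} (hK : K ∈ P.Sig G) :
    conjSub g K ∈ P.Sig G ∧
      FinGrp.restrict (conjSub (g, 1) (diag G)) (conjSub g K) K ∈
        P.𝒮 (G.sub (conjSub g K)) (G.sub K) := by
  have h1 := P.conj_mem G hG G hG _ (P.diag_mem G hG) (g, 1)
  have hm : ∀ x y : G, (x, y) ∈ conjSub (g, (1 : G)) (diag G) ↔ g⁻¹ * x * g = y := by
    intro x y
    rw [mem_conjSub]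
    simp only [Prod.inv_mk, Prod.mk_mul_mk, mem_diag]
    simp
  have h2 := h7.right G hG G hG _ h1 K hK (by
    intro y _
    exact mem_prodSnd.2 ⟨g * y * g⁻¹, (hm _ _).2 (by group)⟩)
  have h3 : starRight (conjSub (g, (1 : G)) (diag G)) K = conjSub g K := by
    ext x
    rw [mem_starRight, mem_conjSub]
    constructor
    · rintro ⟨y, hy, hxy⟩
      rwa [(hm _ _).1 hxy]
    · intro h
      exact ⟨_, h, (hm _ _).2 rfl⟩
  rwa [h3] at h2

theorem mem_conj_graph {G : FinGrp Ω} {g : G} {K L : Subgroup G} {x : G.sub L} {y : G.sub K} :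
    (x, y) ∈ FinGrp.restrict (conjSub (g, (1 : G)) (diag G)) L K ↔
      G.incl _ x = g * G.incl _ y * g⁻¹ := by
  rw [FinGrp.mem_restrict, mem_conjSub]
  simp only [Prod.inv_mk, Prod.mk_mul_mk, mem_diag, inv_one, one_mul, mul_one]
  constructor
  · intro h
    rw [← h]
    group
  · intro h
    rw [h]
    group

variable (P)

/-- The pair `(𝒢, 𝒮⁺)`. -/
def plus (h7 : P.AxiomSeven) (hcap : P.InterClosed) : GSPair Ω where
  𝒢 := P.𝒢
  𝒮 := P.SPlus
  diag_mem := by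
    intro G hG
    have h1 : prodFst (diag G) = ⊤ := by
      ext x
      simpa using mem_prodFst.2 ⟨x, mem_diag.2 rfl⟩
    have h2 : prodSnd (diag G) = ⊤ := by
      ext x
      simpa using mem_prodSnd.2 ⟨x, mem_diag.2 rfl⟩
    have ht : (⊤ : Subgroup G) ∈ P.Sig G := by
      simpa only [Sig, Set.mem_ofPred_eq, FinGrp.sub_top] using hG
    refine ⟨h1 ▸ ht, h2 ▸ ht, ?_⟩
    rw [h1, h2]
    refine mem_S_congr (FinGrp.sub_top G).symm (FinGrp.sub_top G).symm ?_ (P.diag_mem G hG)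
    intro g h g' h' hg hh
    rw [FinGrp.mem_restrict, mem_diag, mem_diag]
    dsimp only
    rw [show G.incl ⊤ g' = g from Subtype.ext (by rw [FinGrp.incl_coe, hg]),
      show G.incl ⊤ h' = h from Subtype.ext (by rw [FinGrp.incl_coe, hh])]
  conj_mem := by
    rintro G hG H hH D ⟨h1, h2, h3⟩ ⟨a, b⟩
    have e1 : prodFst (conjSub (a, b) D) = conjSub a (prodFst D) := by
      ext x
      rw [mem_prodFst, mem_conjSub, mem_prodFst]
      constructor
      · rintro ⟨y, hy⟩
        rw [mem_conjSub] at hy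
        exact ⟨_, hy⟩
      · rintro ⟨y, hy⟩
        refine ⟨b * y * b⁻¹, mem_conjSub.2 ?_⟩
        simpa [mul_assoc] using hy
    have e2 : prodSnd (conjSub (a, b) D) = conjSub b (prodSnd D) := by
      ext x
      rw [mem_prodSnd, mem_conjSub, mem_prodSnd]
      constructor
      · rintro ⟨y, hy⟩
        rw [mem_conjSub] at hy
        exact ⟨_, hy⟩
      · rintro ⟨y, hy⟩
        refine ⟨a * y * a⁻¹, mem_conjSub.2 ?_⟩
        simpa [mul_assoc] using hy
    obtain ⟨a1, a2⟩ := conj_graph_mem h7 hG a h1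
    obtain ⟨b1, b2⟩ := conj_graph_mem h7 hH b h2
    have hb : conjSub b⁻¹ (conjSub b (prodSnd D)) = prodSnd D := by
      ext x
      simp [mem_conjSub, mul_assoc]
    obtain ⟨b3, b4⟩ := conj_graph_mem h7 hH b⁻¹ b1
    rw [hb] at b3 b4
    refine ⟨e1 ▸ a1, e2 ▸ b1, ?_⟩
    rw [e1, e2]
    have key := P.star_mem _ a1 _ b3 _ b1 _ (P.star_mem _ a1 _ h1 _ b3 _ a2 _ h3) _ b4
    convert key using 1
    ext ⟨x, y⟩
    rw [mem_star]
    simp only [mem_star, FinGrp.mem_restrict (D := D), mem_conj_graph]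
    rw [FinGrp.mem_restrict, mem_conjSub]
    dsimp only
    constructor
    · intro h
      simp only [Prod.inv_mk, Prod.mk_mul_mk] at h
      obtain ⟨x', hx'⟩ := G.exists_incl (prodFst D) (mem_prodFst.2 ⟨_, h⟩)
      obtain ⟨y', hy'⟩ := H.exists_incl (prodSnd D) (mem_prodSnd.2 ⟨_, h⟩)
      refine ⟨y', ⟨x', ?_, ?_⟩, ?_⟩
      · rw [hx']; group
      · rw [hx', hy']; exact h
      · rw [hy']; group
    · rintro ⟨y', ⟨x', hx, hxy⟩, hy⟩
      simp only [Prod.inv_mk, Prod.mk_mul_mk]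
      rw [hy] at hxy
      rw [hx]
      simpa [mul_assoc] using hxy
  star_mem := by
    intro G hG H hH K hK D hD E hE
    have hM : prodSnd D ⊓ prodFst E ∈ P.Sig H := hcap H hH _ hD.2.1 _ hE.1
    obtain ⟨d1, d2⟩ := SPlus.right h7 hD hM inf_le_left
    obtain ⟨f1, f2⟩ := SPlus.left h7 hE hM inf_le_right
    have e1 : prodFst (star D E) = starRight D (prodSnd D ⊓ prodFst E) := by
      ext x
      rw [mem_prodFst, mem_starRight]
      constructor
      · rintro ⟨k, h, h1, h2⟩
        exact ⟨h, ⟨mem_prodSnd.2 ⟨_, h1⟩, mem_prodFst.2 ⟨_, h2⟩⟩, h1⟩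
      · rintro ⟨h, ⟨_, h2⟩, h1⟩
        obtain ⟨k, hk⟩ := mem_prodFst.1 h2
        exact ⟨k, h, h1, hk⟩
    have e2 : prodSnd (star D E) = starLeft (prodSnd D ⊓ prodFst E) E := by
      ext x
      rw [mem_prodSnd, mem_starLeft]
      constructor
      · rintro ⟨k, h, h1, h2⟩
        exact ⟨h, ⟨mem_prodSnd.2 ⟨_, h1⟩, mem_prodFst.2 ⟨_, h2⟩⟩, h2⟩
      · rintro ⟨h, ⟨h2, _⟩, h1⟩
        obtain ⟨k, hk⟩ := mem_prodSnd.1 h2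
        exact ⟨k, h, hk, h1⟩
    refine ⟨e1 ▸ d1, e2 ▸ f1, ?_⟩
    rw [e1, e2]
    have key := P.star_mem _ d1 _ hM _ f1 _ d2 _ f2
    convert key using 1
    ext ⟨x, y⟩
    rw [FinGrp.mem_restrict, mem_star, mem_star]
    simp only [FinGrp.mem_restrict]
    constructor
    · rintro ⟨h, h1, h2⟩
      obtain ⟨z, rfl⟩ := H.exists_incl (prodSnd D ⊓ prodFst E)
        ⟨mem_prodSnd.2 ⟨_, h1⟩, mem_prodFst.2 ⟨_, h2⟩⟩
      exact ⟨z, h1, h2⟩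
    · rintro ⟨z, h1, h2⟩
      exact ⟨_, h1, h2⟩

end GSPair

/-! ### Bisets and the group `B(G, H)` -/

/-- A finite `(G, H)`-biset, written as a finite left `(G × H)`-set: `(g, h) • u = g u h⁻¹`. -/
structure Biset (G H : Type u) [Group G] [Group H] where
  carrier : Type u
  [finite : Finite carrier]
  [action : MulAction (G × H) carrier]

namespace Biset

section

variable {G H K L : Type u} [Group G] [Group H] [Group K] [Group L]

instance : CoeSort (Biset G H) (Type u) := ⟨Biset.carrier⟩

instance (U : Biset G H) : Finite U := U.finite

instance (U : Biset G H) : MulAction (G × H) U := U.action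

/-- The stabilizer `(G × H)_u = {(g, h) | g u = u h}`. -/
def stab (U : Biset G H) (u : U) : Subgroup (G × H) := MulAction.stabilizer (G × H) u

/-- Isomorphism of `(G, H)`-bisets. -/
def Iso (U V : Biset G H) : Prop :=
  ∃ e : U ≃ V, ∀ (x : G × H) (u : U), e (x • u) = x • e u

theorem Iso.of_bijective {U V : Biset G H} (φ : U → V) (hi : ∀ x y, φ x = φ y → x = y)
    (hs : ∀ v, ∃ u, φ u = v) (hφ : ∀ (x : G × H) (u : U), φ (x • u) = x • φ u) : Iso U V :=
  ⟨Equiv.ofBijective φ ⟨fun x y h => hi x y h, hs⟩, hφ⟩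

theorem Iso.of_empty {U V : Biset G H} (hU : U → False) (hV : V → False) : Iso U V :=
  Iso.of_bijective (fun u => (hU u).elim) (fun x => (hU x).elim) (fun x => (hV x).elim)
    fun _ u => (hU u).elim

instance isoSetoid (G H : Type u) [Group G] [Group H] : Setoid (Biset G H) where
  r := Iso
  iseqv :=
    { refl := fun U => ⟨Equiv.refl U, fun _ _ => rfl⟩
      symm := fun ⟨e, he⟩ => ⟨e.symm, fun x u => e.injective (by simp [he])⟩
      trans := fun ⟨e, he⟩ ⟨f, hf⟩ => ⟨e.trans f, fun x u => by simp [he, hf]⟩ }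

/-- The disjoint union of two bisets. -/
def coprod (U V : Biset G H) : Biset G H where
  carrier := U ⊕ V

/-- The empty biset. -/
def empty (G H : Type u) [Group G] [Group H] : Biset G H where
  carrier := PEmpty
  action :=
    { smul := fun _ x => x
      one_smul := fun _ => rfl
      mul_smul := fun _ _ _ => rfl }

/-- The transitive biset `(G × H)/D`. -/
def coset [Finite G] [Finite H] (D : Subgroup (G × H)) : Biset G H where
  carrier := (G × H) ⧸ D

/-- The `(G', G)`-biset `G'` with `g' x g = g' x α(g)`, for an isomorphism `α : G → G'`. -/
def ofIso [Finite H] (α : G ≃* H) : Biset H G where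
  carrier := H
  action :=
    { smul := fun y x => y.1 * x * (α y.2)⁻¹
      one_smul := fun x => by
        change (1 : H) * x * (α 1)⁻¹ = x
        simp
      mul_smul := fun y z x => by
        change y.1 * z.1 * x * (α (y.2 * z.2))⁻¹ = y.1 * (z.1 * x * (α z.2)⁻¹) * (α y.2)⁻¹
        simp [mul_assoc] }

/-- The equivalence relation on `U × V` whose classes are the orbits of `H` acting by
`h (u, v) = (u h⁻¹, h v)`. -/
def tensorSetoid (U : Biset G H) (V : Biset H K) : Setoid (U × V) where
  r x y := ∃ h : H, ((1, h) : G × H) • x.1 = y.1 ∧ ((h, 1) : H × K) • x.2 = y.2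
  iseqv :=
    { refl := fun x => ⟨1, one_smul _ _, one_smul _ _⟩
      symm := by
        rintro x y ⟨h, h1, h2⟩
        refine ⟨h⁻¹, ?_, ?_⟩
        · rw [← h1, smul_smul]; simp [← Prod.one_eq_mk]
        · rw [← h2, smul_smul]; simp [← Prod.one_eq_mk]
      trans := by
        rintro x y z ⟨h, h1, h2⟩ ⟨k, k1, k2⟩
        refine ⟨k * h, ?_, ?_⟩
        · rw [← k1, ← h1, smul_smul]; simp
        · rw [← k2, ← h2, smul_smul]; simp }

/-- `U ×_H V`, with `g [u, v] k = [g u, v k]`. -/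
def tensor (U : Biset G H) (V : Biset H K) : Biset G K where
  carrier := Quotient (tensorSetoid U V)
  action :=
    { smul := fun x => Quotient.map
        (fun y => (((x.1, 1) : G × H) • y.1, ((1, x.2) : H × K) • y.2)) (by
          rintro y z ⟨h, h1, h2⟩
          refine ⟨h, ?_, ?_⟩
          · rw [← h1]; simp only [smul_smul, Prod.mk_mul_mk, one_mul, mul_one]
          · rw [← h2]; simp only [smul_smul, Prod.mk_mul_mk, one_mul, mul_one])
      one_smul := by
        rintro ⟨y⟩
        refine congrArg (Quotient.mk _) (Prod.ext ?_ ?_)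
        · exact one_smul (G × H) y.1
        · exact one_smul (H × K) y.2
      mul_smul := by
        rintro a b ⟨y⟩
        refine congrArg (Quotient.mk _) (Prod.ext ?_ ?_)
        · simp [smul_smul]
        · simp [smul_smul] }

/-- The class `[u, v]` in `U ×_H V`. -/
def tmk (U : Biset G H) (V : Biset H K) (u : U) (v : V) : tensor U V :=
  Quotient.mk (tensorSetoid U V) (u, v)

theorem tmk_smul (U : Biset G H) (V : Biset H K) (x : G × K) (u : U) (v : V) :
    x • tmk U V u v = tmk U V (((x.1, 1) : G × H) • u) (((1, x.2) : H × K) • v) := rfl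

theorem tmk_eq {U : Biset G H} {V : Biset H K} {u u' : U} {v v' : V} :
    tmk U V u v = tmk U V u' v' ↔
      ∃ h : H, ((1, h) : G × H) • u = u' ∧ ((h, 1) : H × K) • v = v' :=
  Quotient.eq (r := tensorSetoid U V)

theorem tmk_surj {U : Biset G H} {V : Biset H K} (x : tensor U V) :
    ∃ u v, tmk U V u v = x := by
  obtain ⟨⟨u, v⟩, h⟩ := Quotient.exists_rep x
  exact ⟨u, v, h⟩

theorem mem_stab {U : Biset G H} {u : U} {x : G × H} : x ∈ U.stab u ↔ x • u = u :=
  MulAction.mem_stabilizer_iff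

theorem stab_smul (U : Biset G H) (x : G × H) (u : U) :
    U.stab (x • u) = conjSub x (U.stab u) :=
  MulAction.stabilizer_smul_eq_stabilizer_map_conj x u

theorem stab_tmk (U : Biset G H) (V : Biset H K) (u : U) (v : V) :
    (tensor U V).stab (tmk U V u v) = star (U.stab u) (V.stab v) := by
  ext ⟨g, k⟩
  rw [mem_stab, mem_star, tmk_smul, tmk_eq]
  simp only [mem_stab, smul_smul, Prod.mk_mul_mk, one_mul, mul_one]

/-- Constructor for maps out of `U ×_H V`. -/
def tlift {U : Biset G H} {V : Biset H K} {A : Type*} (f : U → V → A)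
    (hf : ∀ (h : H) (u : U) (v : V), f (((1, h) : G × H) • u) (((h, 1) : H × K) • v) = f u v) :
    tensor U V → A :=
  Quotient.lift (fun x : U × V => f x.1 x.2) (by
    rintro x y ⟨h, h1, h2⟩
    rw [← h1, ← h2, hf])

theorem tensor_congr {U U' : Biset G H} {V V' : Biset H K} (hU : Iso U U') (hV : Iso V V') :
    Iso (tensor U V) (tensor U' V') := by
  obtain ⟨e, he⟩ := hU
  obtain ⟨f, hf⟩ := hV
  let φ : tensor U V → tensor U' V' := tlift (fun u v => tmk U' V' (e u) (f v)) (by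
    intro h u v
    rw [he, hf]
    exact (tmk_eq.2 ⟨h, rfl, rfl⟩).symm)
  have hφ : ∀ u v, φ (tmk U V u v) = tmk U' V' (e u) (f v) := fun _ _ => rfl
  refine Iso.of_bijective φ ?_ ?_ ?_
  · intro x y hxy
    obtain ⟨u, v, rfl⟩ := tmk_surj x
    obtain ⟨u', v', rfl⟩ := tmk_surj y
    rw [hφ, hφ, tmk_eq] at hxy
    obtain ⟨h, h1, h2⟩ := hxy
    rw [← he] at h1
    rw [← hf] at h2
    exact tmk_eq.2 ⟨h, e.injective h1, f.injective h2⟩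
  · intro x
    obtain ⟨u, v, rfl⟩ := tmk_surj x
    exact ⟨tmk U V (e.symm u) (f.symm v), by rw [hφ]; simp⟩
  · intro x y
    obtain ⟨u, v, rfl⟩ := tmk_surj y
    rw [tmk_smul, hφ, hφ, tmk_smul, he, hf]

theorem coprod_congr {U U' V V' : Biset G H} (hU : Iso U U') (hV : Iso V V') :
    Iso (coprod U V) (coprod U' V') := by
  obtain ⟨e, he⟩ := hU
  obtain ⟨f, hf⟩ := hV
  refine ⟨Equiv.sumCongr e f, ?_⟩
  rintro x (u | v)
  · exact congrArg Sum.inl (he x u)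
  · exact congrArg Sum.inr (hf x v)

theorem coprod_tensor (U U' : Biset G H) (V : Biset H K) :
    Iso (tensor (coprod U U') V) (coprod (tensor U V) (tensor U' V)) := by
  let φ : tensor (coprod U U') V → coprod (tensor U V) (tensor U' V) :=
    tlift (fun (u : U ⊕ U') v =>
      (Sum.map (fun x => tmk U V x v) (fun x => tmk U' V x v) u : tensor U V ⊕ tensor U' V)) (by
      rintro h (u | u) v
      · exact congrArg Sum.inl (tmk_eq.2 ⟨h, rfl, rfl⟩).symm
      · exact congrArg Sum.inr (tmk_eq.2 ⟨h, rfl, rfl⟩).symm)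
  refine Iso.of_bijective φ ?_ ?_ ?_
  · intro x y hxy
    obtain ⟨u, v, rfl⟩ := tmk_surj x
    obtain ⟨u', v', rfl⟩ := tmk_surj y
    rcases u with u | u <;> rcases u' with u' | u'
    · obtain ⟨h, h1, h2⟩ := tmk_eq.1 (Sum.inl_injective hxy)
      exact tmk_eq.2 ⟨h, congrArg Sum.inl h1, h2⟩
    · exact (Sum.inl_ne_inr hxy).elim
    · exact (Sum.inr_ne_inl hxy).elim
    · obtain ⟨h, h1, h2⟩ := tmk_eq.1 (Sum.inr_injective hxy)
      exact tmk_eq.2 ⟨h, congrArg Sum.inr h1, h2⟩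
  · rintro (x | x)
    · obtain ⟨u, v, rfl⟩ := tmk_surj x
      exact ⟨tmk (coprod U U') V (Sum.inl u) v, rfl⟩
    · obtain ⟨u, v, rfl⟩ := tmk_surj x
      exact ⟨tmk (coprod U U') V (Sum.inr u) v, rfl⟩
  · intro x y
    obtain ⟨u, v, rfl⟩ := tmk_surj y
    rcases u with u | u <;> rfl

theorem tensor_coprod (U : Biset G H) (V V' : Biset H K) :
    Iso (tensor U (coprod V V')) (coprod (tensor U V) (tensor U V')) := by
  let φ : tensor U (coprod V V') → coprod (tensor U V) (tensor U V') :=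
    tlift (fun u (v : V ⊕ V') =>
      (Sum.map (fun x => tmk U V u x) (fun x => tmk U V' u x) v : tensor U V ⊕ tensor U V')) (by
      rintro h u (v | v)
      · exact congrArg Sum.inl (tmk_eq.2 ⟨h, rfl, rfl⟩).symm
      · exact congrArg Sum.inr (tmk_eq.2 ⟨h, rfl, rfl⟩).symm)
  refine Iso.of_bijective φ ?_ ?_ ?_
  · intro x y hxy
    obtain ⟨u, v, rfl⟩ := tmk_surj x
    obtain ⟨u', v', rfl⟩ := tmk_surj y
    rcases v with v | v <;> rcases v' with v' | v'
    · obtain ⟨h, h1, h2⟩ := tmk_eq.1 (Sum.inl_injective hxy)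
      exact tmk_eq.2 ⟨h, h1, congrArg Sum.inl h2⟩
    · exact (Sum.inl_ne_inr hxy).elim
    · exact (Sum.inr_ne_inl hxy).elim
    · obtain ⟨h, h1, h2⟩ := tmk_eq.1 (Sum.inr_injective hxy)
      exact tmk_eq.2 ⟨h, h1, congrArg Sum.inr h2⟩
  · rintro (x | x)
    · obtain ⟨u, v, rfl⟩ := tmk_surj x
      exact ⟨tmk U (coprod V V') u (Sum.inl v), rfl⟩
    · obtain ⟨u, v, rfl⟩ := tmk_surj x
      exact ⟨tmk U (coprod V V') u (Sum.inr v), rfl⟩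
  · intro x y
    obtain ⟨u, v, rfl⟩ := tmk_surj y
    rcases v with v | v <;> rfl

theorem tensor_assoc (U : Biset G H) (V : Biset H K) (W : Biset K L) :
    Iso (tensor (tensor U V) W) (tensor U (tensor V W)) := by
  let φ : tensor (tensor U V) W → tensor U (tensor V W) :=
    tlift (fun x w => tlift (fun u v => tmk U (tensor V W) u (tmk V W v w)) (by
      intro h u v
      refine (tmk_eq.2 ⟨h, rfl, ?_⟩).symm
      rw [tmk_smul]
      exact congrArg _ (one_smul (K × L) w)) x) (by
      intro k x w
      obtain ⟨u, v, rfl⟩ := tmk_surj x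
      rw [tmk_smul]
      change tmk U (tensor V W) _ (tmk V W _ _) = tmk U (tensor V W) _ (tmk V W _ _)
      congr 1
      · exact one_smul (G × H) u
      · exact (tmk_eq.2 ⟨k, rfl, rfl⟩).symm)
  have hφ : ∀ u v w, φ (tmk (tensor U V) W (tmk U V u v) w) =
    tmk U (tensor V W) u (tmk V W v w) := fun _ _ _ => rfl
  refine Iso.of_bijective φ ?_ ?_ ?_
  · intro x y hxy
    obtain ⟨x, w, rfl⟩ := tmk_surj x
    obtain ⟨u, v, rfl⟩ := tmk_surj x
    obtain ⟨y, w', rfl⟩ := tmk_surj y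
    obtain ⟨u', v', rfl⟩ := tmk_surj y
    rw [hφ, hφ, tmk_eq] at hxy
    obtain ⟨h, h1, h2⟩ := hxy
    rw [tmk_smul, tmk_eq] at h2
    obtain ⟨k, k1, k2⟩ := h2
    refine tmk_eq.2 ⟨k, ?_, ?_⟩
    · rw [tmk_smul, tmk_eq]
      refine ⟨h, ?_, ?_⟩
      · rw [← h1]
        exact congrArg _ (one_smul (G × H) u)
      · rw [← k1, smul_smul, smul_smul]
        simp
    · rw [← k2, smul_smul]
      simp
  · intro x
    obtain ⟨u, x, rfl⟩ := tmk_surj x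
    obtain ⟨v, w, rfl⟩ := tmk_surj x
    exact ⟨tmk (tensor U V) W (tmk U V u v) w, rfl⟩
  · intro x y
    obtain ⟨y, w, rfl⟩ := tmk_surj y
    obtain ⟨u, v, rfl⟩ := tmk_surj y
    rw [tmk_smul, tmk_smul, hφ, hφ, tmk_smul, tmk_smul]

/-- The `(G, G)`-biset `G`, with left and right multiplication. -/
def one (G : Type u) [Group G] [Finite G] : Biset G G := ofIso (MulEquiv.refl G)

theorem one_tensor [Finite G] (U : Biset G H) : Iso (tensor (one G) U) U := by
  let φ : tensor (one G) U → U := tlift (fun (g : G) u => (g, (1 : H)) • u) (by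
    rintro h (g : G) u
    change (((1 * g * h⁻¹ : G), (1 : H)) • ((h, (1 : H)) • u)) = (g, (1 : H)) • u
    rw [smul_smul]
    simp)
  have hφ : ∀ (g : G) u, φ (tmk (one G) U g u) = (g, (1 : H)) • u := fun _ _ => rfl
  refine Iso.of_bijective φ ?_ ?_ ?_
  · intro x y hxy
    obtain ⟨(g : G), u, rfl⟩ := tmk_surj x
    obtain ⟨(g' : G), u', rfl⟩ := tmk_surj y
    rw [hφ, hφ] at hxy
    refine tmk_eq.2 ⟨g'⁻¹ * g, ?_, ?_⟩
    · change (1 * g * (g'⁻¹ * g)⁻¹ : G) = g'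
      group
    · have := congrArg (fun z => ((g'⁻¹, 1) : G × H) • z) hxy
      simp only [smul_smul, Prod.mk_mul_mk, mul_one, inv_mul_cancel] at this
      rw [this]
      exact one_smul (G × H) u'
  · intro u
    exact ⟨tmk (one G) U (1 : G) u, one_smul (G × H) u⟩
  · intro x y
    obtain ⟨(g : G), u, rfl⟩ := tmk_surj y
    change ((x.1 * g * (1 : G)⁻¹), (1 : H)) • (((1, x.2) : G × H) • u) = x • ((g, (1 : H)) • u)
    rw [smul_smul, smul_smul]
    congr 1
    refine Prod.ext ?_ ?_ <;> simp

theorem tensor_one [Finite H] (U : Biset G H) : Iso (tensor U (one H)) U := by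
  let φ : tensor U (one H) → U := tlift (fun u (h : H) => ((1 : G), h⁻¹) • u) (by
    rintro h u (k : H)
    change ((1 : G), (h * k * (1 : H)⁻¹)⁻¹) • (((1, h) : G × H) • u) = ((1 : G), k⁻¹) • u
    rw [smul_smul]
    simp)
  have hφ : ∀ u (h : H), φ (tmk U (one H) u h) = ((1 : G), h⁻¹) • u := fun _ _ => rfl
  refine Iso.of_bijective φ ?_ ?_ ?_
  · intro x y hxy
    obtain ⟨u, (h : H), rfl⟩ := tmk_surj x
    obtain ⟨u', (h' : H), rfl⟩ := tmk_surj y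
    rw [hφ, hφ] at hxy
    refine tmk_eq.2 ⟨h' * h⁻¹, ?_, ?_⟩
    · have := congrArg (fun z => ((1, h') : G × H) • z) hxy
      simp only [smul_smul, Prod.mk_mul_mk, mul_one, mul_inv_cancel] at this
      rw [this]
      exact one_smul (G × H) u'
    · change (h' * h⁻¹ * h * (1 : H)⁻¹ : H) = h'
      group
  · intro u
    exact ⟨tmk U (one H) u (1 : H), by
      rw [hφ, inv_one]; exact one_smul (G × H) u⟩
  · intro x y
    obtain ⟨u, (h : H), rfl⟩ := tmk_surj y
    change ((1 : G), (1 * h * x.2⁻¹)⁻¹) • (((x.1, 1) : G × H) • u) = x • (((1 : G), h⁻¹) • u)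
    rw [smul_smul, smul_smul]
    congr 1
    refine Prod.ext ?_ ?_ <;> simp

/-- A transitive biset is isomorphic to `(G × H)/D`, with `D` a stabilizer. -/
theorem iso_coset [Finite G] [Finite H] (U : Biset G H) (u : U)
    (h : ∀ v : U, ∃ x : G × H, x • u = v) : Iso (coset (U.stab u)) U := by
  refine Iso.of_bijective (MulAction.ofQuotientStabilizer (G × H) u) ?_ ?_ ?_
  · exact MulAction.injective_ofQuotientStabilizer (G × H) u
  · intro v
    obtain ⟨x, rfl⟩ := h v
    exact ⟨(QuotientGroup.mk x : (G × H) ⧸ _), rfl⟩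
  · intro x y
    exact MulAction.ofQuotientStabilizer_smul (G × H) u x y

end

end Biset

/-- Isomorphism classes of finite `(G, H)`-bisets. -/
def BisetClass (G H : Type u) [Group G] [Group H] : Type (u + 1) :=
  Quotient (Biset.isoSetoid G H)

namespace BisetClass

variable {G H K : Type u} [Group G] [Group H] [Group K]

/-- The isomorphism class of a biset. -/
def mk (U : Biset G H) : BisetClass G H := Quotient.mk _ U

theorem mk_eq {U V : Biset G H} : mk U = mk V ↔ Biset.Iso U V :=
  Quotient.eq (r := Biset.isoSetoid G H)

instance : Zero (BisetClass G H) := ⟨mk (Biset.empty G H)⟩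

instance : Add (BisetClass G H) :=
  ⟨Quotient.map₂ Biset.coprod fun _ _ h _ _ h' => Biset.coprod_congr h h'⟩

theorem mk_coprod (U V : Biset G H) : mk (Biset.coprod U V) = mk U + mk V := rfl

theorem mk_empty : mk (Biset.empty G H) = 0 := rfl

/-- The commutative monoid of isomorphism classes under disjoint union. -/
instance : AddCommMonoid (BisetClass G H) where
  nsmul := nsmulRec
  add_assoc := by
    rintro ⟨U⟩ ⟨V⟩ ⟨W⟩
    refine mk_eq.2 ⟨Equiv.sumAssoc U V W, ?_⟩
    rintro x ((u | u) | u) <;> rfl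
  zero_add := by
    rintro ⟨U⟩
    refine mk_eq.2 ⟨Equiv.emptySum PEmpty U, ?_⟩
    rintro x (u | u)
    · exact PEmpty.elim u
    · rfl
  add_zero := by
    rintro ⟨U⟩
    refine mk_eq.2 ⟨Equiv.sumEmpty U PEmpty, ?_⟩
    rintro x (u | u)
    · rfl
    · exact PEmpty.elim u
  add_comm := by
    rintro ⟨U⟩ ⟨V⟩
    refine mk_eq.2 ⟨Equiv.sumComm U V, ?_⟩
    rintro x (u | u) <;> rfl

/-- The map induced by `(U, V) ↦ U ×_H V`. -/
def tensorFun : BisetClass G H → BisetClass H K → BisetClass G K :=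
  Quotient.map₂ Biset.tensor fun _ _ h _ _ h' => Biset.tensor_congr h h'

/-- The biadditive map induced by `(U, V) ↦ U ×_H V`. -/
def tensor : BisetClass G H →+ BisetClass H K →+ BisetClass G K where
  toFun a :=
    { toFun := tensorFun a
      map_zero' := by
        obtain ⟨U⟩ := a
        refine mk_eq.2 (Biset.Iso.of_empty (fun x => ?_) fun x => PEmpty.elim x)
        obtain ⟨_, v, _⟩ := Biset.tmk_surj x
        exact PEmpty.elim v
      map_add' := by
        rintro ⟨V⟩ ⟨W⟩
        obtain ⟨U⟩ := a
        exact mk_eq.2 (Biset.tensor_coprod U V W) }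
  map_zero' := by
    ext ⟨V⟩
    refine mk_eq.2 (Biset.Iso.of_empty (fun x => ?_) fun x => PEmpty.elim x)
    obtain ⟨u, _, _⟩ := Biset.tmk_surj x
    exact PEmpty.elim u
  map_add' := by
    rintro ⟨U⟩ ⟨V⟩
    ext ⟨W⟩
    exact mk_eq.2 (Biset.coprod_tensor U V W)

end BisetClass

/-- `B(G, H)`: the Grothendieck group of finite `(G, H)`-bisets with respect to disjoint unions. -/
abbrev BurnsideGroup (G H : Type u) [Group G] [Group H] : Type (u + 1) :=
  Algebra.GrothendieckAddGroup (BisetClass G H)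

namespace BurnsideGroup

open Algebra

variable {G H K L : Type u} [Group G] [Group H] [Group K] [Group L]

/-- The class `[U]` of a biset in `B(G, H)`. -/
def cls (U : Biset G H) : BurnsideGroup G H := GrothendieckAddGroup.of (BisetClass.mk U)

theorem lift_of {M A : Type*} [AddCommMonoid M] [AddCommGroup A] (f : M →+ A) (x : M) :
    GrothendieckAddGroup.lift f (GrothendieckAddGroup.of x) = f x :=
  DFunLike.congr_fun (GrothendieckAddGroup.lift.symm_apply_apply f) x

theorem lift_ext {M A : Type*} [AddCommMonoid M] [AddCommGroup A]
    {f g : GrothendieckAddGroup M →+ A}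
    (h : ∀ x, f (GrothendieckAddGroup.of x) = g (GrothendieckAddGroup.of x)) : f = g :=
  GrothendieckAddGroup.lift.symm.injective (AddMonoidHom.ext h)

theorem hom_ext {A : Type*} [AddCommGroup A] {f g : BurnsideGroup G H →+ A}
    (h : ∀ U, f (cls U) = g (cls U)) : f = g := by
  apply lift_ext
  rintro ⟨U⟩
  exact h U

theorem cls_congr {U V : Biset G H} (h : Biset.Iso U V) : cls U = cls V :=
  congrArg GrothendieckAddGroup.of (BisetClass.mk_eq.2 h)

theorem cls_coprod (U V : Biset G H) : cls (Biset.coprod U V) = cls U + cls V := by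
  rw [cls, BisetClass.mk_coprod, map_add, cls, cls]

theorem cls_empty : cls (Biset.empty G H) = 0 := by
  rw [cls, BisetClass.mk_empty, map_zero]

/-- The biadditive product `B(G, H) × B(H, K) → B(G, K)` induced by `(U, V) ↦ U ×_H V`. -/
def mul : BurnsideGroup G H →+ BurnsideGroup H K →+ BurnsideGroup G K :=
  GrothendieckAddGroup.lift
    { toFun := fun a => GrothendieckAddGroup.lift (GrothendieckAddGroup.of.comp (BisetClass.tensor a))
      map_zero' := by
        apply lift_ext
        intro b
        rw [lift_of, map_zero]
        exact map_zero GrothendieckAddGroup.of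
      map_add' := by
        intro a a'
        apply lift_ext
        intro b
        rw [AddMonoidHom.add_apply, lift_of, lift_of, lift_of, map_add]
        exact map_add GrothendieckAddGroup.of _ _ }

theorem mul_cls (U : Biset G H) (V : Biset H K) :
    mul (cls U) (cls V) = cls (Biset.tensor U V) := by
  rw [mul, cls, cls, lift_of]
  change GrothendieckAddGroup.lift _ _ = _
  rw [lift_of]
  rfl

theorem mul_assoc' (a : BurnsideGroup G H) (b : BurnsideGroup H K) (c : BurnsideGroup K L) :
    mul (mul a b) c = mul a (mul b c) := by
  have h1 : ∀ (U : Biset G H) (V : Biset H K) (c : BurnsideGroup K L),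
      mul (mul (cls U) (cls V)) c = mul (cls U) (mul (cls V) c) := by
    intro U V
    have : (mul (mul (cls U) (cls V)) : BurnsideGroup K L →+ BurnsideGroup G L) =
        (mul (cls U)).comp (mul (cls V)) := by
      apply hom_ext
      intro W
      rw [AddMonoidHom.comp_apply, mul_cls, mul_cls, mul_cls, mul_cls]
      exact cls_congr (Biset.tensor_assoc U V W)
    exact DFunLike.congr_fun this
  have h2 : ∀ (U : Biset G H) (b : BurnsideGroup H K) (c : BurnsideGroup K L),
      mul (mul (cls U) b) c = mul (cls U) (mul b c) := by
    intro U b c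
    have : (mul.flip c).comp (mul (cls U) : BurnsideGroup H K →+ BurnsideGroup G K) =
        (mul (cls U)).comp (mul.flip c) := hom_ext fun V => h1 U V c
    exact DFunLike.congr_fun this b
  have : (mul.flip c).comp (mul.flip b : BurnsideGroup G H →+ BurnsideGroup G K) =
      mul.flip (mul b c) := hom_ext fun U => h2 U b c
  exact DFunLike.congr_fun this a

/-- The identity `[G] ∈ B(G, G)`. -/
def one (G : Type u) [Group G] [Finite G] : BurnsideGroup G G := cls (Biset.one G)

theorem one_mul' [Finite G] (a : BurnsideGroup G H) : mul (one G) a = a := by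
  have key : mul (one G) = AddMonoidHom.id (BurnsideGroup G H) := by
    apply hom_ext
    intro U
    rw [one, mul_cls]
    exact cls_congr (Biset.one_tensor U)
  rw [key]
  rfl

theorem mul_one' [Finite H] (a : BurnsideGroup G H) : mul a (one H) = a := by
  have key : mul.flip (one H) = AddMonoidHom.id (BurnsideGroup G H) := by
    apply hom_ext
    intro U
    rw [AddMonoidHom.flip_apply, one, mul_cls]
    exact cls_congr (Biset.tensor_one U)
  exact DFunLike.congr_fun key a

end BurnsideGroup

/-! ### The category `𝒟 = 𝒞(𝒢, 𝒮)` and biset functors -/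

namespace Biset

variable {G H : Type u} [Group G] [Group H]

/-- A `(G × H)`-stable subset of a biset. -/
def restrictTo (U : Biset G H) (p : Set U) (hp : ∀ (x : G × H) (u : U), u ∈ p → x • u ∈ p) :
    Biset G H where
  carrier := p
  action :=
    { smul := fun x u => ⟨x • u.1, hp x u.1 u.2⟩
      one_smul := fun u => Subtype.ext (one_smul (G × H) u.1)
      mul_smul := fun x y u => Subtype.ext (mul_smul x y u.1) }

theorem stab_restrictTo (U : Biset G H) (p : Set U)
    (hp : ∀ (x : G × H) (u : U), u ∈ p → x • u ∈ p) (u : U) (hu : u ∈ p) :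
    (U.restrictTo p hp).stab (⟨u, hu⟩ : p) = U.stab u := by
  ext x
  refine mem_stab.trans (Iff.trans ?_ mem_stab.symm)
  exact ⟨fun h => congrArg Subtype.val h, fun h => Subtype.ext h⟩

theorem stab_coset [Finite G] [Finite H] (D : Subgroup (G × H)) (u : coset D) :
    ∃ x : G × H, (coset D).stab u = conjSub x D := by
  obtain ⟨x, rfl⟩ := QuotientGroup.mk_surjective (s := D) u
  refine ⟨x, ?_⟩
  have h1 : (coset D).stab (QuotientGroup.mk 1 : (G × H) ⧸ D) = D :=
    MulAction.stabilizer_quotient D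
  have h2 := stab_smul (coset D) x (QuotientGroup.mk 1 : (G × H) ⧸ D)
  rw [h1] at h2
  rw [← h2]
  exact congrArg (coset D).stab (congrArg (QuotientGroup.mk (s := D)) (mul_one x).symm)

theorem cls_mem_closure [Finite G] [Finite H] (S : Set (Subgroup (G × H))) :
    ∀ (n : ℕ) (U : Biset G H), Nat.card U = n → (∀ u, U.stab u ∈ S) →
      BurnsideGroup.cls U ∈ AddSubgroup.closure {x | ∃ D ∈ S, x = BurnsideGroup.cls (coset D)} := by
  intro n
  induction n using Nat.strong_induction_on with
  | _ n ih =>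
    intro U hn hU
    by_cases hne : Nonempty U
    · obtain ⟨u⟩ := hne
      let p : Set U := {v | ∃ x : G × H, x • u = v}
      have hp : ∀ (x : G × H) (v : U), v ∈ p → x • v ∈ p := by
        rintro x _ ⟨y, rfl⟩
        exact ⟨x * y, mul_smul x y u⟩
      have hq : ∀ (x : G × H) (v : U), v ∈ pᶜ → x • v ∈ pᶜ := by
        rintro x v hv hxv
        apply hv
        have := hp x⁻¹ _ hxv
        rwa [inv_smul_smul] at this
      have hup : u ∈ p := ⟨1, one_smul _ u⟩
      have hiso : Iso (coprod (U.restrictTo p hp) (U.restrictTo pᶜ hq)) U := by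
        classical
        refine ⟨Equiv.Set.sumCompl p, ?_⟩
        rintro x (v | v) <;> rfl
      rw [← BurnsideGroup.cls_congr hiso, BurnsideGroup.cls_coprod]
      apply AddSubgroup.add_mem
      · apply AddSubgroup.subset_closure
        refine ⟨U.stab u, hU u, ?_⟩
        rw [← U.stab_restrictTo p hp u hup]
        refine (BurnsideGroup.cls_congr (iso_coset (U.restrictTo p hp) (⟨u, hup⟩ : p) ?_)).symm
        rintro ⟨v, x, rfl⟩
        exact ⟨x, rfl⟩
      · refine ih (Nat.card (U.restrictTo pᶜ hq)) ?_ _ rfl ?_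
        · rw [← hn]
          change Nat.card (pᶜ : Set U) < _
          exact Finite.card_subtype_lt (x := u) (fun h => h hup)
        · rintro ⟨v, hv⟩
          rw [stab_restrictTo U pᶜ hq v hv]
          exact hU v
    · have : Iso U (empty G H) := Iso.of_empty (fun u => hne ⟨u⟩) fun x => PEmpty.elim x
      rw [BurnsideGroup.cls_congr this, BurnsideGroup.cls_empty]
      exact AddSubgroup.zero_mem _

theorem mem_stab_ofIso [Finite H] (α : G ≃* H) (x : H) (y : H) (g : G) :
    (y, g) ∈ (ofIso α).stab x ↔ y = x * α g * x⁻¹ := by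
  refine mem_stab.trans ?_
  change y * x * (α g)⁻¹ = x ↔ _
  rw [mul_inv_eq_iff_eq_mul, eq_mul_inv_iff_mul_eq]

/-- `T` is a set of representatives `[U/H]` of the `H`-orbits of `U`. -/
def IsOrbitReps (U : Biset G H) (T : Finset U) : Prop :=
  ∀ u : U, ∃! t, t ∈ T ∧ ∃ h : H, ((1, h) : G × H) • u = t

end Biset

namespace GSPair

variable {Ω : Type u} (P : GSPair Ω)

/-- `Hom_𝒟(H, G) = ⟨[(G × H)/D] | D ∈ 𝒮(G, H)⟩ ⊆ B(G, H)`. -/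
def homs (G H : FinGrp Ω) : AddSubgroup (BurnsideGroup G H) :=
  AddSubgroup.closure {x | ∃ D ∈ P.𝒮 G H, x = BurnsideGroup.cls (Biset.coset D)}

variable {P}

theorem cls_mem_homs {G H : FinGrp Ω} (U : Biset G H) (hU : ∀ u, U.stab u ∈ P.𝒮 G H) :
    BurnsideGroup.cls U ∈ P.homs G H :=
  Biset.cls_mem_closure (P.𝒮 G H) _ U rfl hU

theorem one_mem_homs {G : FinGrp Ω} (hG : G ∈ P.𝒢) : BurnsideGroup.one G ∈ P.homs G G := by
  apply cls_mem_homs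
  intro (x : G)
  have h := P.conj_mem G hG G hG _ (P.diag_mem G hG) (x, 1)
  refine Set.mem_of_eq_of_mem ?_ h
  ext ⟨a, b⟩
  refine (Biset.mem_stab_ofIso (MulEquiv.refl G) x a b).trans ?_
  rw [mem_conjSub]
  simp only [Prod.inv_mk, Prod.mk_mul_mk, mem_diag, inv_one, one_mul, mul_one,
    MulEquiv.refl_apply]
  constructor
  · rintro rfl
    group
  · rintro rfl
    group

theorem mul_mem_homs {G H K : FinGrp Ω} (hG : G ∈ P.𝒢) (hH : H ∈ P.𝒢) (hK : K ∈ P.𝒢)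
    {a : BurnsideGroup G H} {b : BurnsideGroup H K} (ha : a ∈ P.homs G H) (hb : b ∈ P.homs H K) :
    BurnsideGroup.mul a b ∈ P.homs G K := by
  have h1 : ∀ D ∈ P.𝒮 G H, ∀ E ∈ P.𝒮 H K, BurnsideGroup.mul (BurnsideGroup.cls (Biset.coset D))
      (BurnsideGroup.cls (Biset.coset E)) ∈ P.homs G K := by
    intro D hD E hE
    rw [BurnsideGroup.mul_cls]
    apply cls_mem_homs
    intro x
    obtain ⟨u, v, rfl⟩ := Biset.tmk_surj x
    rw [Biset.stab_tmk]
    obtain ⟨x, hx⟩ := Biset.stab_coset D u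
    obtain ⟨y, hy⟩ := Biset.stab_coset E v
    rw [hx, hy]
    exact P.star_mem G hG H hH K hK _ (P.conj_mem G hG H hH D hD x) _
      (P.conj_mem H hH K hK E hE y)
  have h2 : ∀ D ∈ P.𝒮 G H,
      P.homs H K ≤ (P.homs G K).comap (BurnsideGroup.mul (BurnsideGroup.cls (Biset.coset D))) := by
    intro D hD
    refine (AddSubgroup.closure_le _).2 ?_
    rintro _ ⟨E, hE, rfl⟩
    exact h1 D hD E hE
  have h3 : P.homs G H ≤ (P.homs G K).comap (BurnsideGroup.mul.flip b) := by
    refine (AddSubgroup.closure_le _).2 ?_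
    rintro _ ⟨D, hD, rfl⟩
    exact h2 D hD hb
  exact h3 ha

variable (P)

/-- The objects of `𝒟 = 𝒞(𝒢, 𝒮)`: the groups in `𝒢`. -/
structure Obj where
  grp : FinGrp Ω
  mem : grp ∈ P.𝒢

/-- The category `𝒟 = 𝒞(𝒢, 𝒮)`: morphisms `H ⟶ G` are the elements of `Hom_𝒟(H, G) ⊆ B(G, H)`,
and the composite of `f : K ⟶ H` and `g : H ⟶ G` is `g ·_H f`. -/
instance : Category.{u + 1} P.Obj where
  Hom H G := P.homs G.grp H.grp
  id G := ⟨BurnsideGroup.one G.grp, one_mem_homs G.mem⟩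
  comp {K H G} f g := ⟨BurnsideGroup.mul g.1 f.1, mul_mem_homs G.mem H.mem K.mem g.2 f.2⟩
  id_comp f := Subtype.ext (BurnsideGroup.mul_one' f.1)
  comp_id f := Subtype.ext (BurnsideGroup.one_mul' f.1)
  assoc f g h := Subtype.ext (BurnsideGroup.mul_assoc' h.1 g.1 f.1).symm

instance : Preadditive P.Obj where
  homGroup H G := inferInstanceAs (AddCommGroup (P.homs G.grp H.grp))
  add_comp _ _ _ f f' g := Subtype.ext (map_add (BurnsideGroup.mul g.1) f.1 f'.1)
  comp_add _ _ _ f g g' :=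
    Subtype.ext (DFunLike.congr_fun (map_add BurnsideGroup.mul g.1 g'.1) f.1)

variable {P}

/-- The morphism `[U] : H ⟶ G` of a `(G, H)`-biset all of whose stabilizers are in `𝒮(G, H)`. -/
def homOfBiset {G H : P.Obj} (U : Biset G.grp H.grp)
    (hU : ∀ u, U.stab u ∈ P.𝒮 G.grp H.grp) : H ⟶ G :=
  ⟨BurnsideGroup.cls U, cls_mem_homs U hU⟩

/-- The morphism `[(G × H)/D] : H ⟶ G` for `D ∈ 𝒮(G, H)`. -/
def homOfMem {G H : P.Obj} (D : Subgroup (G.grp × H.grp)) (hD : D ∈ P.𝒮 G.grp H.grp) : H ⟶ G :=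
  ⟨BurnsideGroup.cls (Biset.coset D), AddSubgroup.subset_closure ⟨D, hD, rfl⟩⟩

/-- A subgroup `K ∈ Σ_𝒢(G)` as an object of `𝒟`. -/
def subObj {G : FinGrp Ω} (K : P.Sig G) : P.Obj := ⟨G.sub K, K.2⟩

/-- The conjugate `ᵍK ∈ Σ_𝒢(G)`. -/
def conjSig (h7 : P.AxiomSeven) {G : FinGrp Ω} (hG : G ∈ P.𝒢) (g : G) (K : P.Sig G) : P.Sig G :=
  ⟨conjSub g K, (conj_graph_mem h7 hG g K.2).1⟩

/-- The conjugation isomorphism `c_g : K → ᵍK`, `k ↦ g k g⁻¹`. -/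
def conjIso {G : FinGrp Ω} (g : G) (K : Subgroup G) : G.sub K ≃* G.sub (conjSub g K) :=
  (G.subIso K).trans (((MulAut.conj g).subgroupMap K).trans (G.subIso (conjSub g K)).symm)

theorem incl_conjIso {G : FinGrp Ω} (g : G) (K : Subgroup G) (k : G.sub K) :
    G.incl _ (conjIso g K k) = g * G.incl K k * g⁻¹ := by
  exact congrArg Subtype.val (MulEquiv.apply_symm_apply (G.subIso (conjSub g K))
    ((MulAut.conj g).subgroupMap K (G.subIso K k)))

/-- The morphism `iso_{c_g} : K ⟶ ᵍK` of `𝒟`. -/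
def conjHom (h7 : P.AxiomSeven) {G : FinGrp Ω} (hG : G ∈ P.𝒢) (g : G) (K : P.Sig G) :
    subObj K ⟶ subObj (conjSig h7 hG g K) :=
  homOfBiset (G := subObj (conjSig h7 hG g K)) (H := subObj K) (Biset.ofIso (conjIso g K.1)) (by
    intro (x : G.sub (conjSub g K.1))
    obtain ⟨h1, h2⟩ := conj_graph_mem h7 hG g K.2
    have h3 := P.conj_mem _ h1 _ K.2 _ h2 (x, 1)
    refine Set.mem_of_eq_of_mem (?_ : (Biset.ofIso (conjIso g K.1)).stab x = _) h3
    ext ⟨a, b⟩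
    refine (Biset.mem_stab_ofIso (conjIso g K.1) x a b).trans ?_
    rw [mem_conjSub]
    simp only [Prod.inv_mk, Prod.mk_mul_mk, inv_one, one_mul, mul_one]
    rw [mem_conj_graph, ← incl_conjIso]
    constructor
    · rintro rfl
      congr 1
      group
    · intro h
      have := G.incl_injective _ h
      rw [← this]
      group)

/-- `K^u = K * (G × H)_u ∈ Σ_𝒢(H)`, for `D = (G × H)_u ∈ 𝒮⁺(G, H)` and `K ≤ p₁(D)`. -/
def leftSig (h7 : P.AxiomSeven) {G H : FinGrp Ω} {D : Subgroup (G × H)} (hD : D ∈ P.SPlus G H)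
    (K : P.Sig G) (hK : K.1 ≤ prodFst D) : P.Sig H :=
  ⟨starLeft K.1 D, (SPlus.left h7 hD K.2 hK).1⟩

/-- The morphism `[(K × K^u)/(K × H)_u] : K^u ⟶ K` of `𝒟`, for `D = (G × H)_u`. -/
def leftHom (h7 : P.AxiomSeven) {G H : FinGrp Ω} {D : Subgroup (G × H)} (hD : D ∈ P.SPlus G H)
    (K : P.Sig G) (hK : K.1 ≤ prodFst D) : subObj (leftSig h7 hD K hK) ⟶ subObj K :=
  homOfMem (G := subObj K) (H := subObj (leftSig h7 hD K hK))
    (FinGrp.restrict D K.1 (starLeft K.1 D)) (SPlus.left h7 hD K.2 hK).2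

end GSPair

/-- The category of biset functors on `𝒟 = 𝒞(𝒢, 𝒮)` over `R`: additive functors to `R`-modules. -/
abbrev BisetFunctor {Ω : Type u} (P : GSPair Ω) (R : Type v) [CommRing R] :=
  P.Obj ⥤+ ModuleCat.{max u w} R

namespace BisetFunctor

variable {Ω : Type u} {P : GSPair Ω} {R : Type v} [CommRing R]

open GSPair

/-- `F⁺(G) = (∏_{K ∈ Σ_𝒢(G)} F(K))^G`: the tuples `a` with `ᵍ(a_K) = a_{ᵍK}` for all `g` and `K`. -/
def plusObj (h7 : P.AxiomSeven) (F : BisetFunctor.{u, v, w} P R) {G : FinGrp Ω} (hG : G ∈ P.𝒢) :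
    Submodule R (∀ K : P.Sig G, F.obj.obj (subObj K)) where
  carrier := {a | ∀ (g : G) (K : P.Sig G),
    (F.obj.map (conjHom h7 hG g K)).hom (a K) = a (conjSig h7 hG g K)}
  add_mem' ha hb g K := by
    rw [Pi.add_apply, map_add, ha g K, hb g K, Pi.add_apply]
  zero_mem' g K := by
    rw [Pi.zero_apply, map_zero, Pi.zero_apply]
  smul_mem' r a ha g K := by
    rw [Pi.smul_apply, map_smul, ha g K, Pi.smul_apply]

open Classical in
/-- The `K`-component of `F⁺(U)(a)`, computed with a set `T` of representatives of the `H`-orbits: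
`∑ F([(K × K^u)/(K × H)_u])(a_{K^u})` over the `u ∈ T` with `K ≤ p₁((G × H)_u)`. -/
def plusMap (h7 : P.AxiomSeven) (F : BisetFunctor.{u, v, w} P R) {G H : FinGrp Ω}
    (U : Biset G H) (hU : ∀ u, U.stab u ∈ P.SPlus G H) (T : Finset U)
    (a : ∀ L : P.Sig H, F.obj.obj (subObj L)) (K : P.Sig G) : F.obj.obj (subObj K) :=
  ∑ u ∈ T, if hK : K.1 ≤ prodFst (U.stab u) then
    (F.obj.map (leftHom h7 (hU u) K hK)).hom (a (leftSig h7 (hU u) K hK)) else 0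

end BisetFunctor

end

/-! The summand of `F⁺(U)(a)_K` at `u` depends on `u` only through its stabilizer `D`. Call it
`plusTerm D K a`: it reads the component of `a` at `starLeft K D` (this is `K^u`) and moves it to
`F(K)` along `[(K × K^u)/(D ∩ (K × K^u))]`. The theorem thus becomes a short list of rules for
`plusTerm`, each summed over orbit representatives.

Conjugating `D` on the right leaves the term unchanged when `a` is an invariant tuple
(`plusTerm_conj_right`), so the choice of representatives is irrelevant. Conjugating on the left
corresponds to applying `c_g` (`plusTerm_conj_left`), so the resulting tuple is again invariant. The
subgroup `Δ(G)` gives `a_K` itself (`plusTerm_diag`), and natural transformations commute with each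
term (`plusTerm_naturality`).

Functoriality rests on `plusTerm_star`: the term of `D * E` is the term of `D` applied to the terms
of `E`. The condition `k₂(D) = 1` enters twice. It makes the right action of `H` on `U` free, so
that products of representatives represent the orbits of `U ×_H V` (`IsOrbitReps.tensor`). It also
makes the range conditions agree: `K ≤ p₁(D * E)` exactly when `K ≤ p₁(D)` and `K * D ≤ p₁(E)`
(`le_prodFst_star`). The morphisms then compose because `D ∩ (K × K^u)` projects onto `K^u`, which
reduces the Mackey formula to a single coset space (`coset_tensor_coset`).

Finally, `U ↦ F⁺(U)` respects isomorphisms and disjoint unions, so it extends additively to `B(G,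
H)`. Compatibility with composition is checked on the generators of the morphism groups of `𝒟⁺`. -/

noncomputable section

namespace Biset

/-! ### Representatives of the right orbits of a biset -/

section OrbitReps

variable {G H K : Type u} [Group G] [Group H] [Group K]

theorem smul_right_right (U : Biset G H) (h k : H) (u : U) :
    ((1, h) : G × H) • ((1, k) : G × H) • u = ((1, h * k) : G × H) • u := by
  rw [smul_smul, Prod.mk_mul_mk, one_mul]

theorem smul_right_inv (U : Biset G H) (h : H) (u : U) :
    ((1, h⁻¹) : G × H) • ((1, h) : G × H) • u = u := by
  rw [smul_right_right, inv_mul_cancel]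
  exact one_smul _ u

/-- Splits the unique-existence condition into covering and irredundancy, which the later arguments
use separately. -/
theorem isOrbitReps_iff {U : Biset G H} {T : Finset U} :
    U.IsOrbitReps T ↔ (∀ u : U, ∃ t ∈ T, ∃ h : H, ((1, h) : G × H) • u = t) ∧
      ∀ s ∈ T, ∀ t ∈ T, ∀ h : H, ((1, h) : G × H) • s = t → s = t := by
  constructor
  · intro hT
    refine ⟨fun u => ?_, fun s hs t ht h hst => ?_⟩
    · obtain ⟨t, ⟨h1, h2⟩, -⟩ := hT u
      exact ⟨t, h1, h2⟩
    · exact (hT s).unique ⟨hs, 1, one_smul _ s⟩ ⟨ht, h, hst⟩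
  · rintro ⟨h1, h2⟩ u
    obtain ⟨t, ht, h, hut⟩ := h1 u
    refine ⟨t, ⟨ht, h, hut⟩, ?_⟩
    rintro s ⟨hs, k, hus⟩
    refine h2 s hs t ht (h * k⁻¹) ?_
    rw [← hus, smul_right_right, inv_mul_cancel_right, hut]

/-- Every biset has a set of representatives of its `H`-orbits. -/
theorem exists_isOrbitReps (U : Biset G H) : ∃ T : Finset U, U.IsOrbitReps T := by
  classical
  let r : Setoid U :=
    { r := fun u v => ∃ h : H, ((1, h) : G × H) • u = v
      iseqv :=
        { refl := fun u => ⟨1, one_smul _ u⟩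
          symm := fun ⟨h, hh⟩ => ⟨h⁻¹, by rw [← hh, smul_right_inv]⟩
          trans := fun ⟨h, hh⟩ ⟨k, hk⟩ => ⟨k * h, by rw [← hk, ← hh, smul_right_right]⟩ } }
  have := Fintype.ofFinite (Quotient r)
  refine ⟨Finset.univ.image (Quotient.out : Quotient r → U), isOrbitReps_iff.2 ⟨fun u => ?_, ?_⟩⟩
  · exact ⟨_, Finset.mem_image_of_mem _ (Finset.mem_univ (Quotient.mk r u)),
      r.symm (Quotient.mk_out (s := r) u)⟩
  · intro s hs t ht h hst
    obtain ⟨x, -, rfl⟩ := Finset.mem_image.1 hs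
    obtain ⟨y, -, rfl⟩ := Finset.mem_image.1 ht
    have hxy : x = y := (Quotient.out_equiv_out (s := r)).1 ⟨h, hst⟩
    rw [hxy]

/-- Sending each element of `T` to its representative in `T'` is a bijection along which `f` is
constant. This gives the independence of `F⁺(U)` from `[U/H]`. -/
theorem IsOrbitReps.sum_eq {M : Type*} [AddCommMonoid M] {U : Biset G H} {T T' : Finset U}
    (hT : U.IsOrbitReps T) (hT' : U.IsOrbitReps T') (f : U → M)
    (hf : ∀ (h : H) (u : U), f (((1, h) : G × H) • u) = f u) :
    ∑ u ∈ T, f u = ∑ u ∈ T', f u := by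
  obtain ⟨-, h2⟩ := isOrbitReps_iff.1 hT
  obtain ⟨h1', h2'⟩ := isOrbitReps_iff.1 hT'
  choose φ hφ c hc using h1'
  refine Finset.sum_bij (fun u _ => φ u) (fun u _ => hφ u) ?_ ?_ ?_
  · intro u hu v hv huv
    -- `c u` carries `u` to the common representative, and `(c v)⁻¹` carries that back to `v`.
    refine h2 u hu v hv ((c v)⁻¹ * c u) ?_
    rw [← smul_right_right, hc, huv, ← hc, smul_right_inv]
  · intro t ht
    obtain ⟨u, ⟨hu, h, htu⟩, -⟩ := hT t
    refine ⟨u, hu, ?_⟩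
    refine (h2' t ht _ (hφ u) (c u * h) ?_).symm
    rw [← smul_right_right, htu, hc]
  · intro u _
    rw [← hc, hf]

/-- Only equivariance on the right is required, so that left translation by an element of `G` is an
admissible `e`. -/
theorem IsOrbitReps.map {U V : Biset G H} {T : Finset U} (hT : U.IsOrbitReps T) (e : U ≃ V)
    (he : ∀ (h : H) (u : U), e (((1, h) : G × H) • u) = ((1, h) : G × H) • e u) :
    V.IsOrbitReps (T.map e.toEmbedding) := by
  obtain ⟨h1, h2⟩ := isOrbitReps_iff.1 hT
  refine isOrbitReps_iff.2 ⟨fun v => ?_, ?_⟩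
  · obtain ⟨t, ht, h, hh⟩ := h1 (e.symm v)
    refine ⟨e t, Finset.mem_map_of_mem e.toEmbedding ht, h, ?_⟩
    rw [← hh, he, e.apply_symm_apply]
  · intro s hs t ht h hst
    obtain ⟨s, hs', rfl⟩ := Finset.mem_map.1 hs
    obtain ⟨t, ht', rfl⟩ := Finset.mem_map.1 ht
    change ((1, h) : G × H) • e s = e t at hst
    rw [← he] at hst
    rw [h2 s hs' t ht' h (e.injective hst)]

theorem IsOrbitReps.coprod {U V : Biset G H} {T : Finset U} {T' : Finset V}
    (hT : U.IsOrbitReps T) (hT' : V.IsOrbitReps T') :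
    (Biset.coprod U V).IsOrbitReps (T.disjSum T' : Finset (U ⊕ V)) := by
  obtain ⟨h1, h2⟩ := isOrbitReps_iff.1 hT
  obtain ⟨h1', h2'⟩ := isOrbitReps_iff.1 hT'
  refine isOrbitReps_iff.2 ⟨?_, ?_⟩
  · rintro (u | u)
    · obtain ⟨t, ht, h, hh⟩ := h1 u
      exact ⟨Sum.inl t, Finset.inl_mem_disjSum.2 ht, h, congrArg Sum.inl hh⟩
    · obtain ⟨t, ht, h, hh⟩ := h1' u
      exact ⟨Sum.inr t, Finset.inr_mem_disjSum.2 ht, h, congrArg Sum.inr hh⟩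
  · rintro (s | s) hs (t | t) ht h hst
    · exact congrArg Sum.inl (h2 s (Finset.inl_mem_disjSum.1 hs) t (Finset.inl_mem_disjSum.1 ht) h
        (Sum.inl_injective hst))
    · exact (Sum.inl_ne_inr hst).elim
    · exact (Sum.inr_ne_inl hst).elim
    · exact congrArg Sum.inr (h2' s (Finset.inr_mem_disjSum.1 hs) t (Finset.inr_mem_disjSum.1 ht) h
        (Sum.inr_injective hst))

/-- The `x ∈ H` identifying the two pairs relates `u` to `u'`, hence `u = u'` and `x` fixes `u`.
Freeness of the right action forces `x = 1`, and then only `k` relates `v` to `v'`. -/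
theorem IsOrbitReps.eq_of_tmk {U : Biset G H} {V : Biset H K} {T : Finset U} {T' : Finset V}
    (hT : U.IsOrbitReps T) (hT' : V.IsOrbitReps T') (hU : ∀ u, kerSnd (U.stab u) = ⊥)
    {u u' : U} {v v' : V} (hu : u ∈ T) (hu' : u' ∈ T) (hv : v ∈ T') (hv' : v' ∈ T') (k : K)
    (h : ((1, k) : G × K) • tmk U V u v = tmk U V u' v') : u = u' ∧ v = v' := by
  obtain ⟨x, hx, hy⟩ := tmk_eq.1 h
  rw [show ((1, 1) : G × H) • u = u from one_smul _ u] at hx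
  obtain rfl := (isOrbitReps_iff.1 hT).2 u hu u' hu' x hx
  have hx1 : x ∈ kerSnd (U.stab u) := mem_stab.2 hx
  rw [hU u, Subgroup.mem_bot] at hx1
  subst hx1
  rw [smul_smul, Prod.mk_mul_mk, one_mul, one_mul] at hy
  exact ⟨rfl, (isOrbitReps_iff.1 hT').2 v hv v' hv' k hy⟩

-- Freeness is needed only for irredundancy. Covering holds in general, since an element of `H` can
-- be moved across the tensor sign.
open Classical in
theorem IsOrbitReps.tensor {U : Biset G H} {V : Biset H K} {T : Finset U} {T' : Finset V}
    (hT : U.IsOrbitReps T) (hT' : V.IsOrbitReps T') (hU : ∀ u, kerSnd (U.stab u) = ⊥) :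
    (Biset.tensor U V).IsOrbitReps ((T ×ˢ T').image fun x => tmk U V x.1 x.2) := by
  refine isOrbitReps_iff.2 ⟨fun x => ?_, ?_⟩
  · obtain ⟨u, v, rfl⟩ := tmk_surj x
    obtain ⟨t, ht, h, hh⟩ := (isOrbitReps_iff.1 hT).1 u
    -- Replacing `u` by its representative through `h` turns `v` into `h v`, so it is `h v` that has
    -- to be represented.
    obtain ⟨t', ht', k, hk⟩ := (isOrbitReps_iff.1 hT').1 (((h, 1) : H × K) • v)
    refine ⟨_, Finset.mem_image_of_mem _ (Finset.mk_mem_product ht ht'), k, ?_⟩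
    rw [tmk_smul, show ((1, 1) : G × H) • u = u from one_smul _ u, tmk_eq]
    refine ⟨h, hh, ?_⟩
    rw [← hk, smul_smul, smul_smul]
    simp
  · intro s hs t ht k hst
    obtain ⟨⟨u, v⟩, huv, rfl⟩ := Finset.mem_image.1 hs
    obtain ⟨⟨u', v'⟩, huv', rfl⟩ := Finset.mem_image.1 ht
    obtain ⟨hu, hv⟩ := Finset.mem_product.1 huv
    obtain ⟨hu', hv'⟩ := Finset.mem_product.1 huv'
    obtain ⟨h1, h2⟩ := hT.eq_of_tmk hT' hU hu hu' hv hv' k hst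
    dsimp only at h1 h2
    subst h1 h2
    rfl

-- Freeness also makes `(u, v) ↦ [u, v]` injective on `T × T'`, so the sum over the image has no
-- collisions.
open Classical in
theorem IsOrbitReps.sum_tensor {M : Type*} [AddCommMonoid M] {U : Biset G H} {V : Biset H K}
    {T : Finset U} {T' : Finset V} (hT : U.IsOrbitReps T) (hT' : V.IsOrbitReps T')
    (hU : ∀ u, kerSnd (U.stab u) = ⊥) (f : Biset.tensor U V → M) :
    ∑ x ∈ (T ×ˢ T').image (fun x => tmk U V x.1 x.2), f x =
      ∑ u ∈ T, ∑ v ∈ T', f (tmk U V u v) := by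
  rw [Finset.sum_image, Finset.sum_product]
  rintro ⟨u, v⟩ huv ⟨u', v'⟩ huv' h
  obtain ⟨hu, hv⟩ := Finset.mem_product.1 (Finset.mem_coe.1 huv)
  obtain ⟨hu', hv'⟩ := Finset.mem_product.1 (Finset.mem_coe.1 huv')
  obtain ⟨h1, h2⟩ := hT.eq_of_tmk hT' hU hu hu' hv hv' 1
    ((one_smul (G × K) (tmk U V u v)).trans h)
  dsimp only at h1 h2
  rw [h1, h2]

theorem isOrbitReps_one [Finite G] : (one G).IsOrbitReps ({(1 : G)} : Finset G) := by
  refine isOrbitReps_iff.2 ⟨fun (g : G) => ⟨(1 : G), Finset.mem_singleton_self _, g, ?_⟩, ?_⟩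
  · change (1 : G) * g * (g : G)⁻¹ = 1
    group
  · intro s hs t ht _ _
    rw [Finset.mem_singleton.1 hs, Finset.mem_singleton.1 ht]

end OrbitReps

/-! ### Products of transitive bisets -/

section Cosets

variable {G H K : Type u} [Group G] [Group H] [Group K]

/-- If `p₂(D) = H`, then `(G × H)/D ×_H (H × K)/E` is isomorphic to `(G × K)/(D * E)`. -/
theorem coset_tensor_coset [Finite G] [Finite H] [Finite K] (D : Subgroup (G × H))
    (E : Subgroup (H × K)) (hD : prodSnd D = ⊤) :
    Iso (coset (star D E)) (tensor (coset D) (coset E)) := by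
  let d : coset D := (QuotientGroup.mk 1 : (G × H) ⧸ D)
  let e : coset E := (QuotientGroup.mk 1 : (H × K) ⧸ E)
  have hs : (tensor (coset D) (coset E)).stab (tmk _ _ d e) = star D E := by
    rw [stab_tmk]
    rw [show (coset D).stab d = D from MulAction.stabilizer_quotient D,
      show (coset E).stab e = E from MulAction.stabilizer_quotient E]
  rw [← hs]
  refine iso_coset _ _ fun x => ?_
  obtain ⟨u, v, rfl⟩ := tmk_surj x
  obtain ⟨⟨h, k⟩, rfl⟩ := QuotientGroup.mk_surjective (s := E) v
  obtain ⟨⟨g, h'⟩, rfl⟩ := QuotientGroup.mk_surjective (s := D) u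
  -- Since `p₂(D)` is everything, some `(x, h'⁻¹ h)` lies in `D`, and `(g, h') D = (g x, h) D`. The
  -- two middle coordinates now agree and cancel, so the class is the `(g x, k)`-translate of the
  -- base point: there is only one orbit.
  have hh : h'⁻¹ * h ∈ prodSnd D := hD ▸ Subgroup.mem_top _
  obtain ⟨x, hx⟩ := mem_prodSnd.1 hh
  refine ⟨(g * x, k), ?_⟩
  rw [tmk_smul]
  refine tmk_eq.2 ⟨h, ?_, ?_⟩
  · change (QuotientGroup.mk ((1, h) * ((g * x, 1) * 1)) : (G × H) ⧸ D) = QuotientGroup.mk (g, h')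
    refine Eq.symm (QuotientGroup.eq.2 ?_)
    simpa using hx
  · change (QuotientGroup.mk ((h, 1) * ((1, k) * 1)) : (H × K) ⧸ E) = QuotientGroup.mk (h, k)
    simp

/-- The biset is transitive and the stabilizer of `1` is the graph of `α`. This brings conjugations
and identities into the coset form in which compositions are computed. -/
theorem iso_coset_ofIso [Finite G] [Finite H] (α : G ≃* H) (D : Subgroup (H × G))
    (hD : ∀ y g, (y, g) ∈ D ↔ y = α g) : Iso (coset D) (ofIso α) := by
  have hs : (ofIso α).stab (1 : H) = D := by
    ext ⟨y, g⟩
    refine (mem_stab_ofIso α 1 y g).trans ?_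
    rw [hD, one_mul, inv_one, mul_one]
  rw [← hs]
  refine iso_coset _ _ fun (v : H) => ⟨(v, 1), ?_⟩
  change v * 1 * (α 1)⁻¹ = v
  simp

end Cosets

end Biset

/-! ### Conjugation, `star` and `starLeft` -/

section Products

variable {G H K : Type u} [Group G] [Group H] [Group K]

theorem mem_conj_left {g x : G} {h : H} {D : Subgroup (G × H)} :
    (x, h) ∈ conjSub (g, (1 : H)) D ↔ (g⁻¹ * x * g, h) ∈ D := by
  simp [mem_conjSub]

theorem mem_conj_right {g : G} {h x : H} {D : Subgroup (G × H)} :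
    (g, x) ∈ conjSub ((1 : G), h) D ↔ (g, h⁻¹ * x * h) ∈ D := by
  simp [mem_conjSub]

theorem prodFst_conj_right (h : H) (D : Subgroup (G × H)) :
    prodFst (conjSub (1, h) D) = prodFst D := by
  ext x
  simp only [mem_prodFst, mem_conj_right]
  exact ⟨fun ⟨y, hy⟩ => ⟨_, hy⟩, fun ⟨y, hy⟩ => ⟨h * y * h⁻¹, by simpa [mul_assoc] using hy⟩⟩

theorem conj_le_prodFst_conj_left {g : G} {L : Subgroup G} {D : Subgroup (G × H)} :
    conjSub g L ≤ prodFst (conjSub (g, 1) D) ↔ L ≤ prodFst D := by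
  constructor
  · intro h x hx
    have := h (mem_conjSub.2 (by simpa [mul_assoc] using hx) : g * x * g⁻¹ ∈ conjSub g L)
    obtain ⟨y, hy⟩ := mem_prodFst.1 this
    exact mem_prodFst.2 ⟨y, by simpa [mul_assoc] using mem_conj_left.1 hy⟩
  · intro h x hx
    obtain ⟨y, hy⟩ := mem_prodFst.1 (h (mem_conjSub.1 hx))
    exact mem_prodFst.2 ⟨y, mem_conj_left.2 hy⟩

theorem starLeft_conj_right (L : Subgroup G) (h : H) (D : Subgroup (G × H)) :
    starLeft L (conjSub (1, h) D) = conjSub h (starLeft L D) := by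
  ext x
  simp only [mem_conjSub (K := starLeft L D), mem_starLeft, mem_conj_right]

theorem starLeft_conj_left (L : Subgroup G) (g : G) (D : Subgroup (G × H)) :
    starLeft (conjSub g L) (conjSub (g, 1) D) = starLeft L D := by
  ext x
  simp only [mem_starLeft, mem_conj_left, mem_conjSub (K := L)]
  exact ⟨fun ⟨y, h1, h2⟩ => ⟨_, h1, h2⟩,
    fun ⟨y, h1, h2⟩ => ⟨g * y * g⁻¹, by simpa [mul_assoc] using h1, by simpa [mul_assoc] using h2⟩⟩

/-- For stabilizers `D` of `u` and `E` of `v` this is `K^[u,v] = (K^u)^v`: both sides of the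
composition law read the same component of the tuple. -/
theorem starLeft_star (L : Subgroup G) (D : Subgroup (G × H)) (E : Subgroup (H × K)) :
    starLeft L (star D E) = starLeft (starLeft L D) E := by
  ext x
  simp only [mem_starLeft, mem_star]
  exact ⟨fun ⟨g, hg, h, h1, h2⟩ => ⟨h, ⟨g, hg, h1⟩, h2⟩,
    fun ⟨h, ⟨g, hg, h1⟩, h2⟩ => ⟨g, hg, h, h1, h2⟩⟩

theorem starLeft_diag (L : Subgroup G) : starLeft L (diag G) = L := by
  ext x
  simp only [mem_starLeft, mem_diag]
  exact ⟨fun ⟨y, hy, h⟩ => h ▸ hy, fun h => ⟨x, h, rfl⟩⟩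

/-- Two elements of `H` that `D` relates to the same `g` differ by an element of `k₂(D)`. When this
is trivial, the intermediate element witnessing `g ∈ p₁(D * E)` is the only partner of `g`, so all
of `L * D` lies in `p₁(E)`. The converse does not use the hypothesis. -/
theorem le_prodFst_star {L : Subgroup G} {D : Subgroup (G × H)} {E : Subgroup (H × K)}
    (hD : kerSnd D = ⊥) :
    L ≤ prodFst (star D E) ↔ L ≤ prodFst D ∧ starLeft L D ≤ prodFst E := by
  constructor
  · intro h
    refine ⟨fun g hg => ?_, ?_⟩
    · obtain ⟨k, y, h1, -⟩ := mem_prodFst.1 (h hg)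
      exact mem_prodFst.2 ⟨y, h1⟩
    · rintro x ⟨g, hg, hx⟩
      obtain ⟨k, y, h1, h2⟩ := mem_prodFst.1 (h hg)
      have hxy : x⁻¹ * y ∈ kerSnd D := by
        change ((1 : G), x⁻¹ * y) ∈ D
        simpa using D.mul_mem (D.inv_mem hx) h1
      rw [hD, Subgroup.mem_bot, inv_mul_eq_one] at hxy
      subst hxy
      exact mem_prodFst.2 ⟨k, h2⟩
  · rintro ⟨h1, h2⟩ g hg
    obtain ⟨y, hy⟩ := mem_prodFst.1 (h1 hg)
    obtain ⟨k, hk⟩ := mem_prodFst.1 (h2 ⟨g, hg, hy⟩)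
    exact mem_prodFst.2 ⟨k, y, hy, hk⟩

end Products

/-! ### Composition of restricted morphisms in `𝒟` -/

namespace GSPair

variable {Ω : Type u} {P : GSPair Ω}

/-- `k₂(D)` lies inside `p₂(D)`, so it is already visible in the restriction of `D` to its
projections, to which the assumption on `𝒮` applies. -/
theorem SPlus.kerSnd_eq (hk : P.KerSndTrivial) {G H : FinGrp Ω} {D : Subgroup (G × H)}
    (hD : D ∈ P.SPlus G H) : kerSnd D = ⊥ := by
  obtain ⟨h1, h2, h3⟩ := hD
  refine (Subgroup.eq_bot_iff_forall _).2 fun h hh => ?_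
  obtain ⟨y, rfl⟩ := H.exists_incl (prodSnd D) (mem_prodSnd.2 ⟨1, hh⟩)
  have hy : y ∈ kerSnd (FinGrp.restrict D (prodFst D) (prodSnd D)) := by
    change (G.incl _ 1, H.incl _ y) ∈ D
    rw [map_one]
    exact hh
  rw [hk _ h1 _ h2 _ h3, Subgroup.mem_bot] at hy
  rw [hy, map_one]

theorem homOfMem_comp {G H K : P.Obj} {D : Subgroup (G.grp × H.grp)}
    (hD : D ∈ P.𝒮 G.grp H.grp) {E : Subgroup (H.grp × K.grp)} (hE : E ∈ P.𝒮 H.grp K.grp)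
    (hDE : star D E ∈ P.𝒮 G.grp K.grp) (h : prodSnd D = ⊤) :
    homOfMem E hE ≫ homOfMem D hD = homOfMem (star D E) hDE :=
  Subtype.ext ((BurnsideGroup.mul_cls _ _).trans
    (BurnsideGroup.cls_congr (Biset.coset_tensor_coset D E h)).symm)

/-- The morphism `[(K × L)/(D ∩ (K × L))] : L ⟶ K` of `𝒟`. -/
def resHom {G H : FinGrp Ω} (D : Subgroup (G × H)) (K : P.Sig G) (L : P.Sig H)
    (hD : FinGrp.restrict D K.1 L.1 ∈ P.𝒮 (G.sub K.1) (H.sub L.1)) : subObj L ⟶ subObj K :=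
  homOfMem (G := subObj K) (H := subObj L) (FinGrp.restrict D K.1 L.1) hD

/-- Reduces an identity of morphisms between subgroups to a statement about elements of the ambient
groups. The condition `L ≤ K * D` says that `D ∩ (K × L)` projects onto `L`, which is what makes the
product a single coset space. -/
theorem resHom_comp {G H J : FinGrp Ω} {D : Subgroup (G × H)} {E : Subgroup (H × J)}
    {B : Subgroup (G × J)} {K : P.Sig G} {L : P.Sig H} {M : P.Sig J}
    (hD : FinGrp.restrict D K.1 L.1 ∈ P.𝒮 (G.sub K.1) (H.sub L.1))
    (hE : FinGrp.restrict E L.1 M.1 ∈ P.𝒮 (H.sub L.1) (J.sub M.1))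
    (hB : FinGrp.restrict B K.1 M.1 ∈ P.𝒮 (G.sub K.1) (J.sub M.1))
    (h : L.1 ≤ starLeft K.1 D)
    (hDE : ∀ g ∈ K.1, ∀ j ∈ M.1, (g, j) ∈ B ↔ ∃ h ∈ L.1, (g, h) ∈ D ∧ (h, j) ∈ E) :
    resHom E L M hE ≫ resHom D K L hD = resHom B K M hB := by
  have hs : star (FinGrp.restrict D K.1 L.1) (FinGrp.restrict E L.1 M.1) =
      FinGrp.restrict B K.1 M.1 := by
    ext ⟨x, y⟩
    rw [mem_star, FinGrp.mem_restrict, hDE _ (G.incl_mem _ _) _ (J.incl_mem _ _)]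
    constructor
    · rintro ⟨z, h1, h2⟩
      exact ⟨_, H.incl_mem _ z, h1, h2⟩
    · rintro ⟨z, hz, h1, h2⟩
      obtain ⟨z, rfl⟩ := H.exists_incl L.1 hz
      exact ⟨z, h1, h2⟩
  have ht : prodSnd (FinGrp.restrict D K.1 L.1) = ⊤ := by
    refine (Subgroup.eq_top_iff' _).2 fun y => ?_
    obtain ⟨g, hg, hgy⟩ := h (H.incl_mem _ y)
    obtain ⟨x, rfl⟩ := G.exists_incl K.1 hg
    exact mem_prodSnd.2 ⟨x, hgy⟩
  unfold resHom
  rw [homOfMem_comp (G := subObj K) (H := subObj L) (K := subObj M) hD hE (hs ▸ hB) ht]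
  congr 1

theorem conjHom_eq (h7 : P.AxiomSeven) {G : FinGrp Ω} (hG : G ∈ P.𝒢) (g : G) (K : P.Sig G) :
    conjHom h7 hG g K = resHom (conjSub (g, 1) (diag G)) (conjSig h7 hG g K) K
      (conj_graph_mem h7 hG g K.2).2 := by
  refine Subtype.ext (BurnsideGroup.cls_congr (Biset.iso_coset_ofIso (conjIso g K.1) _ ?_)).symm
  intro y x
  refine (mem_conj_graph (K := K.1) (L := conjSub g K.1)).trans ?_
  rw [← incl_conjIso]
  exact (G.incl_injective _).eq_iff

theorem resHom_diag {G : FinGrp Ω} (K : P.Sig G)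
    (h : FinGrp.restrict (diag G) K.1 K.1 ∈ P.𝒮 (G.sub K.1) (G.sub K.1)) :
    resHom (diag G) K K h = 𝟙 (subObj K) := by
  refine Subtype.ext (BurnsideGroup.cls_congr
    (Biset.iso_coset_ofIso (MulEquiv.refl (G.sub K.1)) _ ?_))
  intro y x
  rw [FinGrp.mem_restrict, mem_diag]
  exact (G.incl_injective _).eq_iff

end GSPair

/-! ### The summand attached to one stabilizer -/

namespace BisetFunctor

variable {Ω : Type u} {P : GSPair Ω} {R : Type v} [CommRing R]

open GSPair

open Classical in
/-- The summand of `F⁺(U)(a)_K` at an element with stabilizer `D`; it is zero when `D ∉ 𝒮⁺(G, H)` or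
`K` is not contained in `p₁(D)`. -/
def plusTerm (h7 : P.AxiomSeven) (F : BisetFunctor.{u, v, w} P R) {G H : FinGrp Ω}
    (D : Subgroup (G × H)) (K : P.Sig G) :
    (∀ L : P.Sig H, F.obj.obj (subObj L)) →ₗ[R] F.obj.obj (subObj K) :=
  if h : D ∈ P.SPlus G H ∧ K.1 ≤ prodFst D then
    (F.obj.map (leftHom h7 h.1 K h.2)).hom ∘ₗ LinearMap.proj (leftSig h7 h.1 K h.2) else 0

section

variable (h7 : P.AxiomSeven) (F : BisetFunctor.{u, v, w} P R) {G H J : FinGrp Ω}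

theorem plusMap_eq_sum (U : Biset G H) (hU : ∀ u, U.stab u ∈ P.SPlus G H) (T : Finset U)
    (a : ∀ L : P.Sig H, F.obj.obj (subObj L)) (K : P.Sig G) :
    F.plusMap h7 U hU T a K = ∑ u ∈ T, plusTerm h7 F (U.stab u) K a := by
  refine Finset.sum_congr rfl fun u _ => ?_
  by_cases hK : K.1 ≤ prodFst (U.stab u)
  · rw [dif_pos hK, plusTerm, dif_pos ⟨hU u, hK⟩]
    rfl
  · rw [dif_neg hK, plusTerm, dif_neg fun h => hK h.2]
    rfl

theorem plusTerm_of_not {D : Subgroup (G × H)} {K : P.Sig G}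
    (h : ¬(D ∈ P.SPlus G H ∧ K.1 ≤ prodFst D)) (a : ∀ L : P.Sig H, F.obj.obj (subObj L)) :
    plusTerm h7 F D K a = 0 := by
  rw [plusTerm, dif_neg h]
  rfl

/-- `L` is a free variable with an equation, rather than `starLeft K D` itself, so that `F(L)` need
not be transported when two expressions for the same subgroup occur. -/
theorem plusTerm_eq {D : Subgroup (G × H)} (hD : D ∈ P.SPlus G H) {K : P.Sig G}
    (hK : K.1 ≤ prodFst D) (L : P.Sig H) (hL : L.1 = starLeft K.1 D)
    (a : ∀ L : P.Sig H, F.obj.obj (subObj L)) :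
    ∃ h : FinGrp.restrict D K.1 L.1 ∈ P.𝒮 (G.sub K.1) (H.sub L.1),
      plusTerm h7 F D K a = (F.obj.map (resHom D K L h)).hom (a L) := by
  obtain rfl : L = leftSig h7 hD K hK := Subtype.ext hL
  refine ⟨(SPlus.left h7 hD K.2 hK).2, ?_⟩
  rw [plusTerm, dif_pos ⟨hD, hK⟩]
  rfl

theorem map_map_apply {A B C : P.Obj} {f : A ⟶ B} {g : B ⟶ C} {k : A ⟶ C} (h : f ≫ g = k)
    (x : F.obj.obj A) : (F.obj.map g).hom ((F.obj.map f).hom x) = (F.obj.map k).hom x := by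
  rw [← h, F.obj.map_comp]
  rfl

/-- Simultaneous conjugation of `K` and `D` by `g` does not change `K * D`, so both sides read the
same component of `a`, and invariance of `a` plays no role. -/
theorem plusTerm_conj_left (hcap : P.InterClosed) (hG : G ∈ P.𝒢) (hH : H ∈ P.𝒢) (g : G)
    (D : Subgroup (G × H)) (K : P.Sig G) (a : ∀ L : P.Sig H, F.obj.obj (subObj L)) :
    (F.obj.map (conjHom h7 hG g K)).hom (plusTerm h7 F D K a) =
      plusTerm h7 F (conjSub (g, 1) D) (conjSig h7 hG g K) a := by
  have hconj : ∀ (x : G) (E : Subgroup (G × H)), E ∈ P.SPlus G H →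
      conjSub (x, 1) E ∈ P.SPlus G H := fun x E hE =>
    (P.plus h7 hcap).conj_mem G hG H hH E hE (x, 1)
  by_cases h : D ∈ P.SPlus G H ∧ K.1 ≤ prodFst D
  · obtain ⟨hD, hK⟩ := h
    let L := leftSig h7 hD K hK
    obtain ⟨h1, e1⟩ := plusTerm_eq h7 F hD hK L rfl a
    obtain ⟨h2, e2⟩ := plusTerm_eq h7 F (hconj g D hD)
      (K := conjSig h7 hG g K) (conj_le_prodFst_conj_left.2 hK) L
      (starLeft_conj_left K.1 g D).symm a
    rw [e1, e2, conjHom_eq]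
    refine map_map_apply F (resHom_comp _ _ _ ?_ ?_) _
    · intro x hx
      exact ⟨g * x * g⁻¹, mem_conjSub.2 (by simpa [mul_assoc] using hx),
        mem_conj_left.2 (mem_diag.2 (by group))⟩
    · intro x hx y hy
      rw [mem_conj_left]
      constructor
      · intro h
        exact ⟨_, mem_conjSub.1 hx, mem_conj_left.2 (mem_diag.2 rfl), h⟩
      · rintro ⟨z, -, h1, h2⟩
        rw [mem_conj_left, mem_diag] at h1
        rwa [h1]
  · rw [plusTerm_of_not h7 F h, map_zero, plusTerm_of_not]
    rintro ⟨h1, h2⟩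
    refine h ⟨?_, conj_le_prodFst_conj_left.1 h2⟩
    -- Conjugating back shows that `D` lies in `𝒮⁺` if its conjugate does, so the zero cases match.
    have := hconj g⁻¹ _ h1
    convert this using 1
    ext ⟨x, y⟩
    simp [mem_conj_left, mul_assoc]

/-- Here the component being read moves from `L` to its conjugate by `y`. Invariance of `a` replaces
the new component by `c_y` applied to the old one, and `c_y` is absorbed into the conjugated
subgroup. -/
theorem plusTerm_conj_right (hcap : P.InterClosed) (hG : G ∈ P.𝒢) (hH : H ∈ P.𝒢) (y : H)
    (D : Subgroup (G × H)) (K : P.Sig G) {a : ∀ L : P.Sig H, F.obj.obj (subObj L)}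
    (ha : a ∈ F.plusObj h7 hH) :
    plusTerm h7 F (conjSub (1, y) D) K a = plusTerm h7 F D K a := by
  have hconj : ∀ (x : H) (E : Subgroup (G × H)), E ∈ P.SPlus G H →
      conjSub (1, x) E ∈ P.SPlus G H := fun x E hE =>
    (P.plus h7 hcap).conj_mem G hG H hH E hE (1, x)
  by_cases h : D ∈ P.SPlus G H ∧ K.1 ≤ prodFst D
  · obtain ⟨hD, hK⟩ := h
    let L := leftSig h7 hD K hK
    obtain ⟨h1, e1⟩ := plusTerm_eq h7 F hD hK L rfl a
    obtain ⟨h2, e2⟩ := plusTerm_eq h7 F (hconj y D hD) (K := K)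
      (by rwa [prodFst_conj_right]) (conjSig h7 hH y L) (starLeft_conj_right K.1 y D).symm a
    rw [e1, e2, ← ha y L, conjHom_eq]
    refine map_map_apply F (resHom_comp _ _ _ ?_ ?_) _
    · exact (starLeft_conj_right K.1 y D).ge
    · intro x hx z hz
      constructor
      · intro h
        exact ⟨y * z * y⁻¹, mem_conjSub.2 (by simpa [mul_assoc] using hz),
          mem_conj_right.2 (by simpa [mul_assoc] using h),
          mem_conj_left.2 (mem_diag.2 (by group))⟩
      · rintro ⟨t, -, h1, h2⟩
        rw [mem_conj_left, mem_diag] at h2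
        rw [mem_conj_right, h2] at h1
        exact h1
  · rw [plusTerm_of_not h7 F h, plusTerm_of_not]
    rintro ⟨h1, h2⟩
    rw [prodFst_conj_right] at h2
    refine h ⟨?_, h2⟩
    have := hconj y⁻¹ _ h1
    convert this using 1
    ext ⟨x, y⟩
    simp [mem_conj_right, mul_assoc]

/-- By `le_prodFst_star` the two sides vanish for range reasons in the same cases. Otherwise both
read the component at `(K * D) * E`, and `resHom_comp` composes the two morphisms, any intermediate
element lying in `K * D` automatically. -/
theorem plusTerm_star (hcap : P.InterClosed) (hk : P.KerSndTrivial) (hG : G ∈ P.𝒢) (hH : H ∈ P.𝒢)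
    (hJ : J ∈ P.𝒢) {D : Subgroup (G × H)} {E : Subgroup (H × J)} (hD : D ∈ P.SPlus G H)
    (hE : E ∈ P.SPlus H J) (K : P.Sig G) (a : ∀ L : P.Sig J, F.obj.obj (subObj L)) :
    plusTerm h7 F (star D E) K a = plusTerm h7 F D K fun L => plusTerm h7 F E L a := by
  have hDE : star D E ∈ P.SPlus G J := (P.plus h7 hcap).star_mem G hG H hH J hJ D hD E hE
  by_cases hK : K.1 ≤ prodFst D
  · let L := leftSig h7 hD K hK
    obtain ⟨h1, e1⟩ := plusTerm_eq h7 F hD hK L rfl fun L => plusTerm h7 F E L a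
    rw [e1]
    by_cases hL : L.1 ≤ prodFst E
    · let M := leftSig h7 hE L hL
      obtain ⟨h2, e2⟩ := plusTerm_eq h7 F hE hL M rfl a
      obtain ⟨h3, e3⟩ := plusTerm_eq h7 F hDE
        ((le_prodFst_star (SPlus.kerSnd_eq hk hD)).2 ⟨hK, hL⟩) M (starLeft_star K.1 D E).symm a
      rw [e2, e3]
      refine (map_map_apply F (resHom_comp _ _ _ le_rfl ?_) _).symm
      intro x hx z hz
      exact ⟨fun ⟨y, hy1, hy2⟩ => ⟨y, ⟨x, hx, hy1⟩, hy1, hy2⟩, fun ⟨y, _, hy⟩ => ⟨y, hy⟩⟩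
    · rw [plusTerm_of_not h7 F (K := L) fun h => hL h.2, map_zero, plusTerm_of_not]
      exact fun h => hL ((le_prodFst_star (SPlus.kerSnd_eq hk hD)).1 h.2).2
  · rw [plusTerm_of_not h7 F fun h => hK h.2, plusTerm_of_not]
    exact fun h => hK ((le_prodFst_star (SPlus.kerSnd_eq hk hD)).1 h.2).1

theorem plusTerm_diag (hcap : P.InterClosed) (hG : G ∈ P.𝒢) (K : P.Sig G)
    (a : ∀ L : P.Sig G, F.obj.obj (subObj L)) : plusTerm h7 F (diag G) K a = a K := by
  obtain ⟨h, e⟩ := plusTerm_eq h7 F ((P.plus h7 hcap).diag_mem G hG) (K := K)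
    (fun x _ => mem_prodFst.2 ⟨x, mem_diag.2 rfl⟩) K (starLeft_diag K.1).symm a
  rw [e, resHom_diag, F.obj.map_id]
  rfl

theorem plusTerm_naturality {F' : BisetFunctor.{u, v, w} P R} (η : F ⟶ F')
    (D : Subgroup (G × H)) (K : P.Sig G) (a : ∀ L : P.Sig H, F.obj.obj (subObj L)) :
    (η.hom.app (subObj K)).hom (plusTerm h7 F D K a) =
      plusTerm h7 F' D K fun L => (η.hom.app (subObj L)).hom (a L) := by
  by_cases h : D ∈ P.SPlus G H ∧ K.1 ≤ prodFst D
  · rw [plusTerm, plusTerm, dif_pos h, dif_pos h]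
    exact LinearMap.congr_fun (congrArg ModuleCat.Hom.hom
      (η.hom.naturality (leftHom h7 h.1 K h.2))) (a (leftSig h7 h.1 K h.2))
  · rw [plusTerm_of_not h7 F h, plusTerm_of_not h7 F' h, map_zero]

end

end BisetFunctor

/-! ### The maps `F⁺(U)`, their additive extension and the maps `η⁺` -/

namespace BisetFunctor

variable {Ω : Type u} {P : GSPair Ω} {R : Type v} [CommRing R]

open GSPair Algebra

section

variable (h7 : P.AxiomSeven) (hcap : P.InterClosed)
  (F : BisetFunctor.{u, v, w} P R) {G H J : FinGrp Ω}
  (hG : G ∈ P.𝒢) (hH : H ∈ P.𝒢) (hJ : J ∈ P.𝒢)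

theorem plusTerm_stab_smul (hcap : P.InterClosed) (hG : G ∈ P.𝒢) (U : Biset G H)
    (K : P.Sig G) (a : F.plusObj h7 hH) (h : H) (u : U) :
    plusTerm h7 F (U.stab (((1, h) : G × H) • u)) K a.1 = plusTerm h7 F (U.stab u) K a.1 := by
  rw [Biset.stab_smul]
  exact plusTerm_conj_right h7 F hcap hG hH h _ K a.2

/-- The map `F⁺(U) : F⁺(H) → F⁺(G)`; orbits of elements whose stabilizer is not in `𝒮⁺(G, H)`
contribute zero. -/
def plusBiset (U : Biset G H) : F.plusObj h7 hH →ₗ[R] F.plusObj h7 hG :=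
  LinearMap.codRestrict _
    ((LinearMap.pi fun K => ∑ u ∈ U.exists_isOrbitReps.choose, plusTerm h7 F (U.stab u) K) ∘ₗ
      (F.plusObj h7 hH).subtype) (by
    intro a g K
    have hT := U.exists_isOrbitReps.choose_spec
    rw [LinearMap.comp_apply, LinearMap.pi_apply, LinearMap.pi_apply, LinearMap.sum_apply,
      LinearMap.sum_apply, map_sum]
    -- Left translation by `g` commutes with the right action, so `g T` is again a set of
    -- representatives. Applying `c_g` turns the sum over `T` at `K` into the sum over `g T` at the
    -- conjugate of `K`.
    refine Eq.trans ?_ ((hT.map (MulAction.toPerm ((g, 1) : G × H)) ?_).sum_eq hT _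
      fun h u => plusTerm_stab_smul h7 F hH hcap hG U _ a h u)
    · rw [Finset.sum_map]
      refine Finset.sum_congr rfl fun u _ => ?_
      refine (plusTerm_conj_left h7 F hcap hG hH g (U.stab u) K a.1).trans ?_
      rw [← Biset.stab_smul]
      rfl
    · intro h u
      change ((g, 1) : G × H) • ((1, h) : G × H) • u = ((1, h) : G × H) • ((g, 1) : G × H) • u
      rw [smul_smul, smul_smul]
      simp)

/-- Frees the value from the representatives chosen in the definition, so that each later argument
can use adapted ones. -/
theorem plusBiset_apply (U : Biset G H) {T : Finset U} (hT : U.IsOrbitReps T)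
    (a : F.plusObj h7 hH) (K : P.Sig G) :
    (plusBiset h7 hcap F hG hH U a).1 K = ∑ u ∈ T, plusTerm h7 F (U.stab u) K a.1 := by
  refine Eq.trans ?_ (U.exists_isOrbitReps.choose_spec.sum_eq hT _
    fun h u => plusTerm_stab_smul h7 F hH hcap hG U K a h u)
  exact LinearMap.sum_apply _ _ _

theorem plusBiset_congr {U V : Biset G H} (h : Biset.Iso U V) :
    plusBiset h7 hcap F hG hH U = plusBiset h7 hcap F hG hH V := by
  obtain ⟨e, he⟩ := h
  obtain ⟨T, hT⟩ := U.exists_isOrbitReps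
  refine LinearMap.ext fun a => Subtype.ext (funext fun K => ?_)
  rw [plusBiset_apply h7 hcap F hG hH U hT,
    plusBiset_apply h7 hcap F hG hH V (hT.map e fun h u => he _ u), Finset.sum_map]
  refine Finset.sum_congr rfl fun u _ => ?_
  have hs : U.stab u = V.stab (e u) := by
    ext x
    rw [Biset.mem_stab, Biset.mem_stab, ← he, e.apply_eq_iff_eq]
  rw [hs]
  rfl

theorem plusBiset_coprod (U V : Biset G H) : plusBiset h7 hcap F hG hH (Biset.coprod U V) =
    plusBiset h7 hcap F hG hH U + plusBiset h7 hcap F hG hH V := by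
  obtain ⟨T, hT⟩ := U.exists_isOrbitReps
  obtain ⟨T', hT'⟩ := V.exists_isOrbitReps
  refine LinearMap.ext fun a => Subtype.ext (funext fun K => ?_)
  rw [plusBiset_apply h7 hcap F hG hH _ (hT.coprod hT')]
  refine (Finset.sum_disjSum (M := F.obj.obj (subObj K)) T T'
    (fun x : U ⊕ V => plusTerm h7 F ((Biset.coprod U V).stab x) K a.1)).trans ?_
  rw [LinearMap.add_apply]
  refine Eq.trans ?_ (congrArg₂ (· + ·) (plusBiset_apply h7 hcap F hG hH U hT a K)
    (plusBiset_apply h7 hcap F hG hH V hT' a K)).symm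
  refine congrArg₂ (· + ·) (Finset.sum_congr rfl fun u _ => ?_)
    (Finset.sum_congr rfl fun u _ => ?_)
  · rw [show (Biset.coprod U V).stab (Sum.inl u : U ⊕ V) = U.stab u from ?_]
    ext x
    exact Sum.inl_injective.eq_iff (a := x • u)
  · rw [show (Biset.coprod U V).stab (Sum.inr u : U ⊕ V) = V.stab u from ?_]
    ext x
    exact Sum.inr_injective.eq_iff (a := x • u)

theorem plusBiset_empty : plusBiset h7 hcap F hG hH (Biset.empty G H) = 0 := by
  have h : (Biset.empty G H).IsOrbitReps ∅ := fun u => PEmpty.elim u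
  refine LinearMap.ext fun a => Subtype.ext (funext fun K => ?_)
  rw [plusBiset_apply h7 hcap F hG hH _ h, Finset.sum_empty]
  rfl

theorem plusBiset_one : plusBiset h7 hcap F hG hG (Biset.one G) = LinearMap.id := by
  refine LinearMap.ext fun a => Subtype.ext (funext fun K => ?_)
  rw [plusBiset_apply h7 hcap F hG hG _ Biset.isOrbitReps_one]
  refine (Finset.sum_singleton (M := F.obj.obj (subObj K)) _ (1 : G)).trans ?_
  have hs : (Biset.one G).stab (1 : G) = diag G := by
    ext ⟨x, y⟩
    refine (Biset.mem_stab_ofIso (MulEquiv.refl G) 1 x y).trans ?_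
    rw [mem_diag, one_mul, inv_one, mul_one]
    rfl
  rw [hs, plusTerm_diag h7 F hcap hG]
  rfl

/-- With products of representatives on the tensor product, both sides become double sums over `T`
and `T'`. They agree term by term by `plusTerm_star`, the stabilizer of `[u, v]` being the star
product of the two stabilizers. -/
theorem plusBiset_tensor (hk : P.KerSndTrivial) (U : Biset G H) (V : Biset H J)
    (hU : ∀ u, U.stab u ∈ P.SPlus G H)
    (hV : ∀ v, V.stab v ∈ P.SPlus H J) : plusBiset h7 hcap F hG hJ (Biset.tensor U V) =
      plusBiset h7 hcap F hG hH U ∘ₗ plusBiset h7 hcap F hH hJ V := by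
  classical
  obtain ⟨T, hT⟩ := U.exists_isOrbitReps
  obtain ⟨T', hT'⟩ := V.exists_isOrbitReps
  have hU' := fun u => SPlus.kerSnd_eq hk (hU u)
  refine LinearMap.ext fun a => Subtype.ext (funext fun K => ?_)
  rw [plusBiset_apply h7 hcap F hG hJ _ (hT.tensor hT' hU'), hT.sum_tensor hT' hU',
    LinearMap.comp_apply, plusBiset_apply h7 hcap F hG hH _ hT]
  refine Finset.sum_congr rfl fun u _ => ?_
  -- The tuple contributed by a single `v` need not be invariant. Splitting the sum is possible
  -- because `plusTerm` is linear on all tuples.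
  have hb : (plusBiset h7 hcap F hH hJ V a).1 =
      ∑ v ∈ T', fun L => plusTerm h7 F (V.stab v) L a.1 := by
    funext L
    rw [plusBiset_apply h7 hcap F hH hJ _ hT', Finset.sum_apply]
  rw [hb, map_sum]
  refine Finset.sum_congr rfl fun v _ => ?_
  rw [Biset.stab_tmk]
  exact plusTerm_star h7 F hcap hk hG hH hJ (hU u) (hV v) K a.1

/-- The additive extension of `U ↦ F⁺(U)` to `B(G, H)`. -/
def plusBurnside : BurnsideGroup G H →+ (F.plusObj h7 hH →ₗ[R] F.plusObj h7 hG) :=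
  GrothendieckAddGroup.lift (M := BisetClass G H)
    -- The universal property of `B(G, H)` needs a value on every biset, not only on those with
    -- stabilizers in `𝒮⁺`. The default value zero for other orbits provides it and preserves
    -- additivity.
    { toFun := Quotient.lift (plusBiset h7 hcap F hG hH)
        fun _ _ h => plusBiset_congr h7 hcap F hG hH h
      map_zero' := by
        change plusBiset h7 hcap F hG hH (Biset.empty G H) = 0
        exact plusBiset_empty h7 hcap F hG hH
      map_add' := by
        rintro ⟨U⟩ ⟨V⟩
        exact plusBiset_coprod h7 hcap F hG hH U V }

theorem plusBurnside_cls (U : Biset G H) : plusBurnside h7 hcap F hG hH (BurnsideGroup.cls U) =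
    plusBiset h7 hcap F hG hH U :=
  BurnsideGroup.lift_of _ _

theorem stab_coset_mem (h7 : P.AxiomSeven) (hcap : P.InterClosed) (hG : G ∈ P.𝒢) (hH : H ∈ P.𝒢)
    {D : Subgroup (G × H)} (hD : D ∈ P.SPlus G H) (u : Biset.coset D) :
    (Biset.coset D).stab u ∈ P.SPlus G H := by
  obtain ⟨x, hx⟩ := Biset.stab_coset D u
  rw [hx]
  exact (P.plus h7 hcap).conj_mem G hG H hH D hD x

/-- Both sides are biadditive, so generators of the two morphism groups suffice. The restriction to
`homs` is what supplies stabilizers in `𝒮⁺`: those of `(G × H)/D` are conjugates of `D`. -/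
theorem plusBurnside_mul (hk : P.KerSndTrivial) {a : BurnsideGroup G H} {b : BurnsideGroup H J}
    (ha : a ∈ (P.plus h7 hcap).homs G H) (hb : b ∈ (P.plus h7 hcap).homs H J) :
    plusBurnside h7 hcap F hG hJ (BurnsideGroup.mul a b) =
      plusBurnside h7 hcap F hG hH a ∘ₗ plusBurnside h7 hcap F hH hJ b := by
  induction ha using AddSubgroup.closure_induction with
  | mem x hx =>
    obtain ⟨D, hD, rfl⟩ := hx
    induction hb using AddSubgroup.closure_induction with
    | mem y hy =>
      obtain ⟨E, hE, rfl⟩ := hy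
      rw [BurnsideGroup.mul_cls, plusBurnside_cls, plusBurnside_cls, plusBurnside_cls]
      exact plusBiset_tensor h7 hcap F hG hH hJ hk _ _ (stab_coset_mem h7 hcap hG hH hD)
        (stab_coset_mem h7 hcap hH hJ hE)
    | zero => rw [map_zero, map_zero, map_zero, LinearMap.comp_zero]
    | add y z _ _ h1 h2 => rw [map_add, map_add, map_add, LinearMap.comp_add, h1, h2]
    | neg y _ h1 => rw [map_neg, map_neg, map_neg, LinearMap.comp_neg, h1]
  | zero => rw [map_zero, AddMonoidHom.zero_apply, map_zero, map_zero, LinearMap.zero_comp]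
  | add y z _ _ h1 h2 =>
    rw [map_add, AddMonoidHom.add_apply, map_add, map_add, LinearMap.add_comp, h1, h2]
  | neg y _ h1 =>
    rw [map_neg, AddMonoidHom.neg_apply, map_neg, map_neg, LinearMap.neg_comp, h1]

/-- The map `η⁺_G : F⁺(G) → F'⁺(G)`, `(a_K) ↦ (η_K(a_K))`. -/
def plusNat {F F' : BisetFunctor.{u, v, w} P R} (η : F ⟶ F') :
    F.plusObj h7 hG →ₗ[R] F'.plusObj h7 hG :=
  LinearMap.restrict (LinearMap.pi fun K => (η.hom.app (subObj K)).hom ∘ₗ LinearMap.proj K) (by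
    intro a ha g K
    -- Naturality of `η` at the conjugation morphisms keeps the image tuple invariant.
    exact (LinearMap.congr_fun (congrArg ModuleCat.Hom.hom
      (η.hom.naturality (conjHom h7 hG g K))) (a K)).symm.trans
        (congrArg (η.hom.app (subObj (conjSig h7 hG g K))).hom (ha g K)))

theorem plusNat_apply {F F' : BisetFunctor.{u, v, w} P R} (η : F ⟶ F') (a : F.plusObj h7 hG)
    (K : P.Sig G) : (plusNat h7 hG η a).1 K = (η.hom.app (subObj K)).hom (a.1 K) := rfl

/-- Both sides are additive in `x`, and on the class of a biset the identity holds summand by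
summand. It is valid on all of `B(G, H)`, since orbits outside `𝒮⁺` give zero on both sides. -/
theorem plusNat_plusBurnside {F F' : BisetFunctor.{u, v, w} P R} (η : F ⟶ F')
    (x : BurnsideGroup G H) :
    plusNat h7 hG η ∘ₗ plusBurnside h7 hcap F hG hH x =
      plusBurnside h7 hcap F' hG hH x ∘ₗ plusNat h7 hH η := by
  let l : BurnsideGroup G H →+ (F.plusObj h7 hH →ₗ[R] F'.plusObj h7 hG) :=
    { toFun := fun x => plusNat h7 hG η ∘ₗ plusBurnside h7 hcap F hG hH x
      map_zero' := by rw [map_zero, LinearMap.comp_zero]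
      map_add' := fun x y => by rw [map_add, LinearMap.comp_add] }
  let r : BurnsideGroup G H →+ (F.plusObj h7 hH →ₗ[R] F'.plusObj h7 hG) :=
    { toFun := fun x => plusBurnside h7 hcap F' hG hH x ∘ₗ plusNat h7 hH η
      map_zero' := by rw [map_zero, LinearMap.zero_comp]
      map_add' := fun x y => by rw [map_add, LinearMap.add_comp] }
  suffices h : l = r from DFunLike.congr_fun h x
  refine BurnsideGroup.hom_ext (A := F.plusObj h7 hH →ₗ[R] F'.plusObj h7 hG) fun U =>
    LinearMap.ext fun a => Subtype.ext (funext fun K => ?_)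
  change (plusNat h7 hG η (plusBurnside h7 hcap F hG hH (BurnsideGroup.cls U) a)).1 K =
    (plusBurnside h7 hcap F' hG hH (BurnsideGroup.cls U) (plusNat h7 hH η a)).1 K
  obtain ⟨T, hT⟩ := U.exists_isOrbitReps
  rw [plusBurnside_cls, plusBurnside_cls, plusNat_apply,
    plusBiset_apply h7 hcap F hG hH U hT, plusBiset_apply h7 hcap F' hG hH U hT, map_sum]
  exact Finset.sum_congr rfl fun u _ => plusTerm_naturality h7 F η (U.stab u) K a.1

end

/-! ### Assembly of the functors -/

/-- The biset functor `F⁺` on `𝒟⁺`. -/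
def plus (h7 : P.AxiomSeven) (hcap : P.InterClosed) (hk : P.KerSndTrivial)
    (F : BisetFunctor.{u, v, w} P R) : BisetFunctor.{u, v, w} (P.plus h7 hcap) R where
  obj :=
    { obj := fun G => ModuleCat.of R (F.plusObj h7 G.mem)
      map := fun {H G} f => ModuleCat.ofHom (plusBurnside h7 hcap F G.mem H.mem f.1)
      map_id := fun G => congrArg ModuleCat.ofHom
        ((plusBurnside_cls h7 hcap F G.mem G.mem _).trans (plusBiset_one h7 hcap F G.mem))
      map_comp := fun {K H G} f g => congrArg ModuleCat.ofHom
        (plusBurnside_mul h7 hcap F G.mem H.mem K.mem hk g.2 f.2) }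
  property := ⟨fun {H G} {f g} => congrArg ModuleCat.ofHom
    (map_add (plusBurnside h7 hcap F G.mem H.mem) f.1 g.1)⟩

/-- The functor `F ↦ F⁺`. -/
def plusFunctor (R : Type v) [CommRing R] (h7 : P.AxiomSeven) (hcap : P.InterClosed)
    (hk : P.KerSndTrivial) :
    BisetFunctor.{u, v, w} P R ⥤ BisetFunctor.{u, v, w} (P.plus h7 hcap) R where
  obj F := F.plus h7 hcap hk
  map η := ⟨
    { app := fun G => ModuleCat.ofHom (plusNat h7 G.mem η)
      naturality := fun {H G} f => congrArg ModuleCat.ofHom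
        (plusNat_plusBurnside h7 hcap G.mem H.mem η f.1) }⟩
  map_id _ := rfl
  map_comp _ _ := rfl

end BisetFunctor

theorem mainTheorem2 {Ω : Type u} (R : Type v) [CommRing R] (P : GSPair Ω)
    (h7 : P.AxiomSeven) (hcap : P.InterClosed) (hk : P.KerSndTrivial) :
    ∃ Φ : BisetFunctor.{u, v, w} P R ⥤ BisetFunctor.{u, v, w} (P.plus h7 hcap) R,
      Φ.Additive ∧ Φ.Linear R ∧
      ∃ hobj : ∀ (F : BisetFunctor.{u, v, w} P R) (G : (P.plus h7 hcap).Obj),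
          (Φ.obj F).obj.obj G = ModuleCat.of R (F.plusObj h7 G.mem),
        (∀ (F : BisetFunctor.{u, v, w} P R) (G H : (P.plus h7 hcap).Obj)
          (U : Biset G.grp H.grp) (hU : ∀ u, U.stab u ∈ (P.plus h7 hcap).𝒮 G.grp H.grp)
          (T : Finset U), U.IsOrbitReps T →
          ∀ (a : F.plusObj h7 H.mem) (K : P.Sig G.grp),
            ((eqToHom (hobj F H).symm ≫ (Φ.obj F).obj.map (GSPair.homOfBiset U hU) ≫
              eqToHom (hobj F G)).hom a).1 K = F.plusMap h7 U hU T a.1 K) ∧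
        (∀ (F F' : BisetFunctor.{u, v, w} P R) (η : F ⟶ F') (G : (P.plus h7 hcap).Obj)
          (a : F.plusObj h7 G.mem) (K : P.Sig G.grp),
            ((eqToHom (hobj F G).symm ≫ (Φ.map η).hom.app G ≫ eqToHom (hobj F' G)).hom a).1 K =
              (η.hom.app (GSPair.subObj K)).hom (a.1 K)) := by
  -- The object equalities hold by `rfl`, so the `eqToHom` factors are identities by definition.
  -- Additivity and `R`-linearity hold because `η⁺` is formed componentwise.
  refine ⟨BisetFunctor.plusFunctor R h7 hcap hk, ⟨rfl⟩, ⟨fun _ _ => rfl⟩, fun _ _ => rfl, ?_, ?_⟩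
  · intro F G H U hU T hT a K
    rw [BisetFunctor.plusMap_eq_sum h7 F U hU T a.1 K]
    refine Eq.trans ?_ (BisetFunctor.plusBiset_apply h7 hcap F G.mem H.mem U hT a K)
    exact congrArg (fun f => (f a).1 K) (BisetFunctor.plusBurnside_cls h7 hcap F G.mem H.mem U)
  · intro F F' η G a K
    rfl

end
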